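/- Let $\mathcal G$ be a connected compact metric graph, given by a finite connected graph with vertex set $\mathsf V$ and nonempty edge set $\mathsf E$ (parallel edges and loops are allowed) in which every edge $\mathsf e$ is identified with an interval $[0,\ell_{\mathsf e}]$, $0<\ell_{\mathsf e}<\infty$. Let $\mathsf V_D\subset\mathsf V$ be a set of vertices of degree one, let $\alpha_{\mathsf v}\in\mathbb R$ for $\mathsf v\in\mathsf V\setminus\mathsf V_D$, and let $q_{\mathsf e}\in\mathbb R$ for $\mathsf e\in\mathsf E$. Let $H$ be the operator acting on every edge $\mathsf e$ as $\psi\mapsto-\psi''+q_{\mathsf e}\psi$, whose domain consists of the real-valued functions $\psi$ that are edgewise in $H^2(0,\ell_{\mathsf e})$ and satisfy * the Dirichlet condition $\psi(\mathsf v)=0$ at every $\mathsf v\in\mathsf V_D$; * the $\delta$-coupling condition at every $\mathsf v\in\mathsf V\setminus\mathsf V_D$: $\psi$ is continuous in $\mathsf v$ and $\sum_{\mathsf e}\partial_{\mathsf e}\psi(\mathsf v)=\alpha_{\mathsf v}\psi(\mathsf v)$, where the sum runs over all edge ends at $\mathsf v$ and $\partial_{\mathsf e}\psi(\mathsf v)$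 is the outward derivative of $\psi$ on $\mathsf e$ at $\mathsf v$ (for $\alpha_{\mathsf v}=0$ these are the standard, or Kirchhoff-Neumann, conditions). Then the following hold. 1. If $\mathcal G$ is a tree and $\mathsf V_D=\emptyset$, then there are a strictly increasing sequence $(\lambda_k)_{k\in\mathbb N}$ of eigenvalues of $H$ of multiplicity one and a sequence of corresponding eigenfunctions $(\psi_k)_{k\in\mathbb N}$ such that no $\psi_k$ vanishes at any vertex of $\mathcal G$. 2. If $\mathsf V_D\neq\emptyset$ ($\mathcal G$ not necessarily being a tree), then there are a strictly increasing sequence $(\lambda_k)_{k\in\mathbb N}$ of eigenvalues of $H$ and a sequence of corresponding eigenfunctions $(\psi_k)_{k\in\mathbb N}$ of full support, i.e. no $\psi_k$ vanishes identically on any edge of $\mathcal G$. -/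

import Mathlib

open MeasureTheory

/-- A finite metric graph with vertex set `V` and edge set `E` (parallel edges and loops are
allowed): each edge `e` is identified with the interval `[0, len e]`, the point `0` being glued to
the initial vertex and the point `len e` to the terminal vertex of `e`. -/
structure MetricGraph (V E : Type*) where
  init : E → V
  term : E → V
  len : E → ℝ
  len_pos : ∀ e, 0 < len e

/-- `f` belongs to the Sobolev space `H²(0, ℓ)` (`f` being the continuous representative on
`[0, ℓ]`), with first derivative `g` and second derivative `h`: the function `f` is a primitive of
`g`, and `g` is a primitive of the square integrable function `h`. -/
structure IsSobolevH2 (ℓ : ℝ) (f : Set.Icc (0 : ℝ) ℓ → ℝ) (g h : ℝ → ℝ) : Prop where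
  memLp : MemLp h 2 (volume.restrict (Set.Icc 0 ℓ))
  deriv_primitive : ∀ x y : Set.Icc (0 : ℝ) ℓ, g y - g x = ∫ t in (x : ℝ)..y, h t
  primitive : ∀ x y : Set.Icc (0 : ℝ) ℓ, f y - f x = ∫ t in (x : ℝ)..y, g t

namespace IsSobolevH2

variable {ℓ : ℝ} {f f₁ f₂ : Set.Icc (0 : ℝ) ℓ → ℝ} {g h g₁ h₁ g₂ h₂ : ℝ → ℝ}

theorem intervalIntegrable_second (H : IsSobolevH2 ℓ f g h) (x y : Set.Icc (0 : ℝ) ℓ) :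
    IntervalIntegrable h volume x y := by
  have hi : IntegrableOn h (Set.Icc 0 ℓ) volume := H.memLp.integrable (by norm_num)
  rw [intervalIntegrable_iff]
  exact hi.mono_set (Set.uIoc_subset_uIcc.trans (Set.uIcc_subset_Icc x.2 y.2))

theorem intervalIntegrable_first (H : IsSobolevH2 ℓ f g h) (x y : Set.Icc (0 : ℝ) ℓ) :
    IntervalIntegrable g volume x y := by
  have h0 : (0 : ℝ) ≤ ℓ := x.2.1.trans x.2.2
  have hi : IntegrableOn h (Set.uIcc 0 ℓ) volume := by
    rw [Set.uIcc_of_le h0]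
    exact H.memLp.integrable (by norm_num)
  have hc : ContinuousOn (fun z => g 0 + ∫ t in (0 : ℝ)..z, h t) (Set.uIcc 0 ℓ) :=
    continuousOn_const.add (intervalIntegral.continuousOn_primitive_interval hi)
  have hg : ContinuousOn g (Set.uIcc (x : ℝ) y) := by
    refine (hc.congr ?_).mono ?_
    · intro z hz
      rw [Set.uIcc_of_le h0] at hz
      have := H.deriv_primitive ⟨0, le_rfl, h0⟩ ⟨z, hz⟩
      simp only at this ⊢
      linarith
    · rw [Set.uIcc_of_le h0]
      exact Set.uIcc_subset_Icc x.2 y.2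
  exact hg.intervalIntegrable

theorem zero : IsSobolevH2 ℓ 0 0 0 where
  memLp := MemLp.zero
  deriv_primitive := by intro x y; simp
  primitive := by intro x y; simp

theorem add (H₁ : IsSobolevH2 ℓ f₁ g₁ h₁) (H₂ : IsSobolevH2 ℓ f₂ g₂ h₂) :
    IsSobolevH2 ℓ (f₁ + f₂) (g₁ + g₂) (h₁ + h₂) where
  memLp := H₁.memLp.add H₂.memLp
  deriv_primitive := by
    intro x y
    simp only [Pi.add_apply]
    rw [intervalIntegral.integral_add (H₁.intervalIntegrable_second x y)
      (H₂.intervalIntegrable_second x y), ← H₁.deriv_primitive, ← H₂.deriv_primitive]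
    ring
  primitive := by
    intro x y
    simp only [Pi.add_apply]
    rw [intervalIntegral.integral_add (H₁.intervalIntegrable_first x y)
      (H₂.intervalIntegrable_first x y), ← H₁.primitive, ← H₂.primitive]
    ring

theorem smul (c : ℝ) (H : IsSobolevH2 ℓ f g h) : IsSobolevH2 ℓ (c • f) (c • g) (c • h) where
  memLp := H.memLp.const_smul c
  deriv_primitive := by
    intro x y
    simp only [Pi.smul_apply, smul_eq_mul]
    rw [intervalIntegral.integral_const_mul, ← H.deriv_primitive]
    ring
  primitive := by
    intro x y
    simp only [Pi.smul_apply, smul_eq_mul]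
    rw [intervalIntegral.integral_const_mul, ← H.primitive]
    ring

end IsSobolevH2

namespace MetricGraph

variable {V E : Type*} (G : MetricGraph V E)

/-- The simple graph on the vertices obtained by forgetting loops and multiplicities of edges. -/
def toSimpleGraph : SimpleGraph V :=
  SimpleGraph.fromRel (fun v w => ∃ e, G.init e = v ∧ G.term e = w)

/-- The metric graph is connected. -/
def Connected : Prop := G.toSimpleGraph.Connected

/-- The metric graph is a tree: it is connected and has no cycles, in particular no loops and no
parallel edges. -/
def IsTree : Prop :=
  (∀ e, G.init e ≠ G.term e) ∧ Function.Injective (fun e => s(G.init e, G.term e)) ∧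
    G.toSimpleGraph.IsTree

/-- The degree of a vertex: the number of edge ends at it. -/
noncomputable def degree (v : V) : ℕ :=
  Nat.card {e : E // G.init e = v} + Nat.card {e : E // G.term e = v}

/-- Families of real functions on the edges `[0, len e]`. -/
abbrev EdgeFun : Type _ := (e : E) → Set.Icc (0 : ℝ) (G.len e) → ℝ

/-- The end of the edge `e` at its initial vertex. -/
def initPt (e : E) : Set.Icc (0 : ℝ) (G.len e) := ⟨0, le_rfl, (G.len_pos e).le⟩

/-- The end of the edge `e` at its terminal vertex. -/
def termPt (e : E) : Set.Icc (0 : ℝ) (G.len e) := ⟨G.len e, (G.len_pos e).le, le_rfl⟩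

/-- `ψ` takes the value `c` at the vertex `v` along every edge end at `v`
(so that `ψ` is continuous in `v`). -/
def HasValueAt (ψ : G.EdgeFun) (v : V) (c : ℝ) : Prop :=
  (∀ e, G.init e = v → ψ e (G.initPt e) = c) ∧ (∀ e, G.term e = v → ψ e (G.termPt e) = c)

open Classical in
/-- The sum over all edge ends at `v` of the outward derivatives, where `g e` is the derivative
of the function on the edge `e` along the parametrization by `[0, len e]`. -/
noncomputable def outwardDerivSum [Fintype E] (g : E → ℝ → ℝ) (v : V) : ℝ :=
  ∑ e, ((if G.init e = v then -g e 0 else 0) + (if G.term e = v then g e (G.len e) else 0))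

/-- `ψ` belongs to the domain of the operator with Dirichlet conditions at the vertices in `VD`
and `δ`-coupling conditions with coupling constant `α v` at the other vertices `v` (standard
conditions if `α v = 0`), and has the first and second edgewise derivatives `g` and `h`. -/
structure InDomain [Fintype E] (VD : Set V) (α : V → ℝ) (ψ : G.EdgeFun) (g h : E → ℝ → ℝ) :
    Prop where
  sobolev : ∀ e, IsSobolevH2 (G.len e) (ψ e) (g e) (h e)
  dirichlet : ∀ v ∈ VD, G.HasValueAt ψ v 0
  delta : ∀ v ∉ VD, ∃ c, G.HasValueAt ψ v c ∧ G.outwardDerivSum g v = α v * c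

/-- The eigenspace for `lam` of the operator acting as `-ψ'' + q e * ψ` on each edge `e`: the space
of all `ψ` in the domain with `-ψ'' + q e * ψ = lam * ψ` (in `L²`, i.e. almost everywhere) on each
edge. -/
def eigenspace [Fintype E] (VD : Set V) (α : V → ℝ) (q : E → ℝ) (lam : ℝ) :
    Submodule ℝ G.EdgeFun where
  carrier := {ψ | ∃ g h : E → ℝ → ℝ, G.InDomain VD α ψ g h ∧
    ∀ e, ∀ᵐ x : ℝ, ∀ hx : x ∈ Set.Icc 0 (G.len e),
      -h e x + q e * ψ e ⟨x, hx⟩ = lam * ψ e ⟨x, hx⟩}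
  zero_mem' := by
    refine ⟨0, 0, ⟨fun e => IsSobolevH2.zero, ?_, ?_⟩, ?_⟩
    · intro v _
      exact ⟨fun e _ => rfl, fun e _ => rfl⟩
    · intro v _
      refine ⟨0, ⟨fun e _ => rfl, fun e _ => rfl⟩, ?_⟩
      simp [outwardDerivSum]
    · intro e
      exact Filter.Eventually.of_forall (by intro x hx; simp)
  add_mem' := by
    rintro ψ₁ ψ₂ ⟨g₁, h₁, D₁, H₁⟩ ⟨g₂, h₂, D₂, H₂⟩
    refine ⟨g₁ + g₂, h₁ + h₂, ⟨fun e => (D₁.sobolev e).add (D₂.sobolev e), ?_, ?_⟩, ?_⟩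
    · intro v hv
      have A₁ := D₁.dirichlet v hv
      have A₂ := D₂.dirichlet v hv
      constructor
      · intro e he
        simp [A₁.1 e he, A₂.1 e he]
      · intro e he
        simp [A₁.2 e he, A₂.2 e he]
    · intro v hv
      obtain ⟨c₁, A₁, B₁⟩ := D₁.delta v hv
      obtain ⟨c₂, A₂, B₂⟩ := D₂.delta v hv
      refine ⟨c₁ + c₂, ⟨?_, ?_⟩, ?_⟩
      · intro e he
        simp [A₁.1 e he, A₂.1 e he]
      · intro e he
        simp [A₁.2 e he, A₂.2 e he]
      · rw [mul_add, ← B₁, ← B₂]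
        simp only [outwardDerivSum, Pi.add_apply]
        rw [← Finset.sum_add_distrib]
        refine Finset.sum_congr rfl fun e _ => ?_
        split_ifs <;> ring
    · intro e
      filter_upwards [H₁ e, H₂ e] with x hx₁ hx₂ hx
      have a := hx₁ hx
      have b := hx₂ hx
      simp only [Pi.add_apply]
      linarith
  smul_mem' := by
    rintro c ψ ⟨g, h, D, H⟩
    refine ⟨c • g, c • h, ⟨fun e => (D.sobolev e).smul c, ?_, ?_⟩, ?_⟩
    · intro v hv
      have A := D.dirichlet v hv
      constructor
      · intro e he
        simp [A.1 e he]
      · intro e he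
        simp [A.2 e he]
    · intro v hv
      obtain ⟨d, A, B⟩ := D.delta v hv
      refine ⟨c * d, ⟨?_, ?_⟩, ?_⟩
      · intro e he
        simp [A.1 e he]
      · intro e he
        simp [A.2 e he]
      · rw [mul_left_comm, ← B]
        simp only [outwardDerivSum, Pi.smul_apply, smul_eq_mul]
        rw [Finset.mul_sum]
        refine Finset.sum_congr rfl fun e _ => ?_
        split_ifs <;> ring
    · intro e
      filter_upwards [H e] with x hx₁ hx
      have a := hx₁ hx
      simp only [Pi.smul_apply, smul_eq_mul]
      linear_combination c * a

/-- `ψ` is an eigenfunction for the eigenvalue `lam`. -/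
def IsEigenfunction [Fintype E] (VD : Set V) (α : V → ℝ) (q : E → ℝ) (lam : ℝ)
    (ψ : G.EdgeFun) : Prop :=
  ψ ∈ G.eigenspace VD α q lam ∧ ψ ≠ 0

/-- `ψ` does not vanish at the vertex `v`, along any edge end at `v`. -/
def NonvanishingAt (ψ : G.EdgeFun) (v : V) : Prop :=
  (∀ e, G.init e = v → ψ e (G.initPt e) ≠ 0) ∧ (∀ e, G.term e = v → ψ e (G.termPt e) ≠ 0)

/-- `ψ` has full support: it does not vanish identically on any edge. -/
def HasFullSupport (ψ : G.EdgeFun) : Prop := ∀ e, ∃ x, ψ e x ≠ 0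

end MetricGraph

/-! By simultaneous recurrence there are times `t → ∞` for which all `t * len e` are almost
multiples of `2π`. At the energy `k ^ 2` with `k = t + δ`, the wave number `√(k ^ 2 - q e)` differs
from `k` by `o(1)`, so the phase on the edge `e` is nearly `δ * len e` modulo `2π`, and the
couplings enter only through `α v / k → 0`. Hence the secular problem near `t` is a small
perturbation of that of the free graph at the small wave number `δ`. Letting `δ` cross a suitable
interval produces an eigenvalue near every late `t`, and its eigenfunction inherits the properties
of a low-lying free one.

Tree: the model is the constant function at `δ = 0`. Drop the coupling condition at a root and
prescribe the root value instead. At zero phases this linear system is invertible, since a tree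
carries no circulating flow (`IsTree.isUnit_rootedSystem`), so nearby it has a unique solution with
all vertex values close to one. The dropped condition is a scalar equation, whose defect has
opposite signs at `-δ` and `δ` (`mul_sin_neg`). At a zero of the defect, uniqueness gives
multiplicity one.

Dirichlet vertices: the model is a ground state. For phases in `(0, π)`, eliminating the edges
leaves a quadratic form in the vertex values with negative off-diagonal terms. It is positive
definite for small `δ` and takes a negative value once the longest edge has phase near `π`. At the
first degenerate parameter (`exists_vertexForm_critical`) a Perron–Frobenius argument yields a null
vector positive off `VD`. An edge with two Dirichlet ends is the whole graph, and there the sine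
functions are explicit. -/

/-! ### Trigonometric solutions on one edge -/

/-- The function `A cos (k x) + B sin (k x)` is of class `H²`. -/
theorem isSobolevH2_trig (ℓ k A B : ℝ) :
    IsSobolevH2 ℓ (fun x => A * Real.cos (k * x) + B * Real.sin (k * x))
      (fun x => k * (B * Real.cos (k * x) - A * Real.sin (k * x)))
      (fun x => -k ^ 2 * (A * Real.cos (k * x) + B * Real.sin (k * x))) := by
  have hlin : ∀ x : ℝ, HasDerivAt (fun y : ℝ => k * y) k x := fun x => by
    simpa using (hasDerivAt_id x).const_mul k
  refine ⟨?_, fun x y => ?_, fun x y => ?_⟩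
  · have hc : Continuous fun x : ℝ =>
        -k ^ 2 * (A * Real.cos (k * x) + B * Real.sin (k * x)) := by fun_prop
    refine MemLp.of_bound hc.aestronglyMeasurable (k ^ 2 * (|A| + |B|)) ?_
    refine Filter.Eventually.of_forall fun x => ?_
    rw [Real.norm_eq_abs, abs_mul, abs_neg, abs_of_nonneg (sq_nonneg k)]
    refine mul_le_mul_of_nonneg_left ((abs_add_le _ _).trans ?_) (sq_nonneg k)
    rw [abs_mul, abs_mul]
    exact add_le_add (mul_le_of_le_one_right (abs_nonneg _) (Real.abs_cos_le_one _))
      (mul_le_of_le_one_right (abs_nonneg _) (Real.abs_sin_le_one _))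
  · symm
    refine intervalIntegral.integral_eq_sub_of_hasDerivAt
      (f := fun x => k * (B * Real.cos (k * x) - A * Real.sin (k * x)))
      (fun z _ => ?_) (Continuous.intervalIntegrable (by fun_prop) _ _)
    exact ((((hlin z).cos.const_mul B).sub ((hlin z).sin.const_mul A)).const_mul k).congr_deriv
      (by ring)
  · symm
    refine intervalIntegral.integral_eq_sub_of_hasDerivAt
      (f := fun x => A * Real.cos (k * x) + B * Real.sin (k * x))
      (fun z _ => ?_) (Continuous.intervalIntegrable (by fun_prop) _ _)
    exact (((hlin z).cos.const_mul A).add ((hlin z).sin.const_mul B)).congr_deriv (by ring)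

/-- Every `H²`-solution of `-f'' = k² f` on `[0, ℓ]` is trigonometric. -/
theorem IsSobolevH2.eq_trig {ℓ k : ℝ} (hℓ : 0 ≤ ℓ) (hk : k ≠ 0) {f : Set.Icc (0 : ℝ) ℓ → ℝ}
    {g h : ℝ → ℝ} (H : IsSobolevH2 ℓ f g h)
    (hode : ∀ᵐ x : ℝ, ∀ hx : x ∈ Set.Icc 0 ℓ, h x = -k ^ 2 * f ⟨x, hx⟩) (x : Set.Icc (0 : ℝ) ℓ) :
    f x = f ⟨0, le_rfl, hℓ⟩ * Real.cos (k * x) + g 0 / k * Real.sin (k * x) ∧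
      g x = k * (g 0 / k * Real.cos (k * x) - f ⟨0, le_rfl, hℓ⟩ * Real.sin (k * x)) := by
  set o : Set.Icc (0 : ℝ) ℓ := ⟨0, le_rfl, hℓ⟩ with ho
  have hgc : ∀ y : Set.Icc (0 : ℝ) ℓ, IntervalIntegrable g volume 0 y := fun y =>
    H.intervalIntegrable_first o y
  have hfc : Continuous f := by
    have hi : IntegrableOn g (Set.uIcc 0 ℓ) volume := by
      have := hgc ⟨ℓ, hℓ, le_rfl⟩
      rwa [intervalIntegrable_iff, Set.uIoc_of_le hℓ, ← integrableOn_Icc_iff_integrableOn_Ioc,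
        ← Set.uIcc_of_le hℓ] at this
    have hc := intervalIntegral.continuousOn_primitive_interval hi
    rw [Set.uIcc_of_le hℓ, continuousOn_iff_continuous_domRestrict] at hc
    have h2 : f = fun y => f o + Set.domRestrict (Set.Icc 0 ℓ) (fun z => ∫ t in (0 : ℝ)..z, g t) y := by
      funext y
      have := H.primitive o y
      simp only [Set.domRestrict_apply]
      change f y - f o = ∫ t in (0 : ℝ)..y, g t at this
      linarith
    rw [h2]
    exact continuous_const.add hc
  -- Extending `f` continuously to the line makes the primitives below differentiable everywhere,
  -- although `h` is known only almost everywhere.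
  set F : ℝ → ℝ := Set.IccExtend hℓ f with hF
  have hFc : Continuous F := hfc.Icc_extend'
  have hFf : ∀ y : Set.Icc (0 : ℝ) ℓ, F y = f y := fun y => Set.IccExtend_val hℓ f y
  set g' : ℝ → ℝ := fun y => g 0 + ∫ t in (0 : ℝ)..y, -k ^ 2 * F t with hg'
  have hg'd : ∀ y, HasDerivAt g' (-k ^ 2 * F y) y := fun y =>
    ((continuous_const.mul hFc).integral_hasStrictDerivAt 0 y).hasDerivAt.const_add _
  have hg'c : Continuous g' := continuous_iff_continuousAt.2 fun y => (hg'd y).continuousAt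
  have hgg : ∀ y : Set.Icc (0 : ℝ) ℓ, g y = g' y := by
    intro y
    have h1 := H.deriv_primitive o y
    have h2 : ∫ t in (0 : ℝ)..y, h t = ∫ t in (0 : ℝ)..y, -k ^ 2 * F t := by
      refine intervalIntegral.integral_congr_ae ?_
      filter_upwards [hode] with t ht hty
      rw [Set.uIoc_of_le y.2.1] at hty
      have hmem : t ∈ Set.Icc 0 ℓ := ⟨hty.1.le, hty.2.trans y.2.2⟩
      rw [ht hmem, ← hFf ⟨t, hmem⟩]
    simp only [ho, hg'] at h1 ⊢
    linarith
  set f' : ℝ → ℝ := fun y => f o + ∫ t in (0 : ℝ)..y, g' t with hf'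
  have hf'd : ∀ y, HasDerivAt f' (g' y) y := fun y =>
    (hg'c.integral_hasStrictDerivAt 0 y).hasDerivAt.const_add _
  have hff : ∀ y : Set.Icc (0 : ℝ) ℓ, f y = f' y := by
    intro y
    have h1 := H.primitive o y
    have h2 : ∫ t in (0 : ℝ)..y, g t = ∫ t in (0 : ℝ)..y, g' t := by
      refine intervalIntegral.integral_congr fun t ht => ?_
      rw [Set.uIcc_of_le y.2.1] at ht
      exact hgg ⟨t, ht.1, ht.2.trans y.2.2⟩
    simp only [ho, hf'] at h1 ⊢
    linarith
  have hlin : ∀ y : ℝ, HasDerivAt (fun y : ℝ => k * y) k y := fun y => by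
    simpa using (hasDerivAt_id y).const_mul k
  -- Rotating `(f, g / k)` back by the angle `k y` gives two conserved quantities, whose values at
  -- `0` are the two coefficients.
  have hPd : ∀ y ∈ Set.Ico 0 ℓ,
      HasDerivAt (fun y => f' y * Real.cos (k * y) - g' y / k * Real.sin (k * y)) 0 y := by
    intro y hy
    have e : F y = f' y := (hFf ⟨y, hy.1, hy.2.le⟩).trans (hff ⟨y, hy.1, hy.2.le⟩)
    refine (((hf'd y).mul (hlin y).cos).sub (((hg'd y).div_const k).mul (hlin y).sin)).congr_deriv ?_
    rw [e]; field_simp; ring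
  have hQd : ∀ y ∈ Set.Ico 0 ℓ,
      HasDerivAt (fun y => f' y * Real.sin (k * y) + g' y / k * Real.cos (k * y)) 0 y := by
    intro y hy
    have e : F y = f' y := (hFf ⟨y, hy.1, hy.2.le⟩).trans (hff ⟨y, hy.1, hy.2.le⟩)
    refine (((hf'd y).mul (hlin y).sin).add (((hg'd y).div_const k).mul (hlin y).cos)).congr_deriv ?_
    rw [e]; field_simp; ring
  have hf'c : Continuous f' := continuous_iff_continuousAt.2 fun y => (hf'd y).continuousAt
  have hP := constant_of_has_deriv_right_zero (Continuous.continuousOn (by fun_prop))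
    (fun y hy => (hPd y hy).hasDerivWithinAt) x x.2
  have hQ := constant_of_has_deriv_right_zero (Continuous.continuousOn (by fun_prop))
    (fun y hy => (hQd y hy).hasDerivWithinAt) x x.2
  have hf0 : f' 0 = f o := by simp [hf']
  have hg0 : g' 0 = g 0 := by simp [hg']
  simp only [mul_zero, Real.cos_zero, Real.sin_zero, hf0, hg0, mul_one, sub_zero, zero_add] at hP hQ
  have hsc := Real.sin_sq_add_cos_sq (k * (x : ℝ))
  rw [hff x, hgg x, ← hP, ← hQ]
  constructor
  · linear_combination (-f' x) * hsc
  · field_simp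
    linear_combination (-g' x) * hsc

/-! ### Eigenfunctions as trigonometric coefficients on the graph -/

namespace MetricGraph

variable {V E : Type*} (G : MetricGraph V E)

/-- The function with value `a v` at the initial ends of the edges at `v`, of the form
`a cos (k x) + B sin (k x)` on every edge. -/
noncomputable def trigFun (k : E → ℝ) (a : V → ℝ) (B : E → ℝ) : G.EdgeFun :=
  fun e x => a (G.init e) * Real.cos (k e * x) + B e * Real.sin (k e * x)

open Classical in
/-- The sum of the outward derivatives at `v` of a trigonometric function, where `r` are the wave
numbers, and `c`, `s` the values of the cosine and the sine at the terminal ends. -/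
noncomputable def trigFlux [Fintype E] (r c s : E → ℝ) (a : V → ℝ) (B : E → ℝ) (v : V) : ℝ :=
  ∑ e, ((if G.init e = v then -(r e * B e) else 0) +
    (if G.term e = v then r e * (B e * c e - a (G.init e) * s e) else 0))

theorem trigFun_mem_eigenspace [Fintype E] {VD : Set V} {α : V → ℝ} {q k : E → ℝ} {lam : ℝ}
    (hk : ∀ e, k e ^ 2 = lam - q e) {a : V → ℝ} {B : E → ℝ} (ha : ∀ v ∈ VD, a v = 0)
    (hedge : ∀ e, a (G.term e) = a (G.init e) * Real.cos (k e * G.len e) +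
      B e * Real.sin (k e * G.len e))
    (hflux : ∀ v ∉ VD, G.trigFlux k (fun e => Real.cos (k e * G.len e))
      (fun e => Real.sin (k e * G.len e)) a B v = α v * a v) :
    G.trigFun k a B ∈ G.eigenspace VD α q lam := by
  have hval : ∀ v, G.HasValueAt (G.trigFun k a B) v (a v) := by
    refine fun v => ⟨fun e he => ?_, fun e he => ?_⟩
    · simp [trigFun, initPt, he]
    · simp [trigFun, termPt, ← he, hedge e]
  refine ⟨fun e x => k e * (B e * Real.cos (k e * x) - a (G.init e) * Real.sin (k e * x)),
    fun e x => -k e ^ 2 * (a (G.init e) * Real.cos (k e * x) + B e * Real.sin (k e * x)),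
    ⟨fun e => isSobolevH2_trig _ _ _ _, fun v hv => ha v hv ▸ hval v,
      fun v hv => ⟨a v, hval v, ?_⟩⟩, fun e => Filter.Eventually.of_forall fun x hx => ?_⟩
  · rw [← hflux v hv]
    simp [outwardDerivSum, trigFlux]
  · simp only [trigFun, hk]
    ring

/-- Completeness of the trigonometric ansatz, needed to bound the multiplicity. Nonzero wave numbers
exclude affine solutions. -/
theorem exists_eq_trigFun_of_mem_eigenspace [Fintype E] {α : V → ℝ} {q k : E → ℝ} {lam : ℝ}
    (hk : ∀ e, k e ^ 2 = lam - q e) (hk0 : ∀ e, k e ≠ 0) {ψ : G.EdgeFun}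
    (hψ : ψ ∈ G.eigenspace ∅ α q lam) :
    ∃ (a : V → ℝ) (B : E → ℝ), ψ = G.trigFun k a B ∧
      (∀ e, a (G.term e) = a (G.init e) * Real.cos (k e * G.len e) +
        B e * Real.sin (k e * G.len e)) ∧
      ∀ v, G.trigFlux k (fun e => Real.cos (k e * G.len e))
        (fun e => Real.sin (k e * G.len e)) a B v = α v * a v := by
  obtain ⟨g, h, D, hode⟩ := hψ
  choose a ha hflux using fun v => D.delta v (Set.notMem_empty v)
  have key := fun e => (D.sobolev e).eq_trig (G.len_pos e).le (hk0 e) (by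
    filter_upwards [hode e] with x hx hx'
    have := hx hx'
    rw [hk]; linarith)
  have h0 : ∀ e, ψ e (G.initPt e) = a (G.init e) := fun e => (ha _).1 e rfl
  refine ⟨a, fun e => g e 0 / k e, ?_, fun e => ?_, fun v => ?_⟩
  · funext e x
    rw [(key e x).1, trigFun, ← h0]
    rfl
  · rw [← (ha (G.term e)).2 e rfl, (key e _).1, ← h0]
    rfl
  · rw [← hflux v, trigFlux, outwardDerivSum]
    refine Finset.sum_congr rfl fun e _ => ?_
    have h2 := (key e (G.termPt e)).2
    simp only [termPt] at h2
    rw [h2, ← h0, mul_div_cancel₀ _ (hk0 e)]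
    rfl

end MetricGraph

/-! ### Simultaneous recurrence and asymptotics of the phases -/

section Recurrence

open Filter Topology

/-- In a compact torus, `0` is a cluster point of the multiples of every point. -/
theorem exists_nat_norm_mul_lt {E : Type*} [Fintype E] (ℓ : E → ℝ) (N : ℕ) {ε : ℝ} (hε : 0 < ε) :
    ∃ n : ℕ, N ≤ n ∧ ∀ e, |n * ℓ e - round ((2 * Real.pi)⁻¹ * (n * ℓ e)) * (2 * Real.pi)| < ε := by
  have : Fact (0 < 2 * Real.pi) := ⟨Real.two_pi_pos⟩
  have h := mapClusterPt_zero_atTop_nsmul (fun e => (ℓ e : AddCircle (2 * Real.pi)))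
  have h2 := h.frequently (Metric.ball_mem_nhds _ hε)
  obtain ⟨n, hn, hb⟩ := h2.forall_exists_of_atTop N
  refine ⟨n, hn, fun e => ?_⟩
  rw [dist_zero_right, pi_norm_lt_iff hε] at hb
  have := hb e
  rw [Pi.smul_apply, ← AddCircle.coe_nsmul, AddCircle.norm_eq, nsmul_eq_mul] at this
  exact this

/-- Simultaneous recurrence: there are arbitrarily large times `t` for which all `t * ℓ e` are
almost integer multiples of `2 π`. -/
theorem exists_tendsto_mul_sub_int_mul_two_pi {E : Type*} [Fintype E] (ℓ : E → ℝ) :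
    ∃ (t : ℕ → ℝ) (m : ℕ → E → ℤ), Tendsto t atTop atTop ∧
      ∀ e, Tendsto (fun n => t n * ℓ e - m n e * (2 * Real.pi)) atTop (𝓝 0) := by
  choose T hT hTε using fun n : ℕ =>
    exists_nat_norm_mul_lt ℓ n (ε := 1 / ((n : ℝ) + 1)) (by positivity)
  refine ⟨fun n => T n, fun n e => round ((2 * Real.pi)⁻¹ * (T n * ℓ e)), ?_, fun e => ?_⟩
  · exact tendsto_atTop_mono (fun n => Nat.cast_le.2 (hT n)) tendsto_natCast_atTop_atTop
  · exact squeeze_zero_norm (fun n => (hTε n e).le) tendsto_one_div_add_atTop_nhds_zero_nat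

/-- The difference times the sum `√(k ^ 2 - q) + k` is `-q`, so the potential shifts phases only by
`O(1 / k)`. -/
theorem tendsto_sqrt_sq_sub_sub (q : ℝ) :
    Tendsto (fun k : ℝ => √(k ^ 2 - q) - k) atTop (𝓝 0) := by
  have h1 : Tendsto (fun k : ℝ => |q| / k) atTop (𝓝 0) := tendsto_const_nhds.div_atTop tendsto_id
  refine squeeze_zero_norm' ?_ h1
  filter_upwards [eventually_ge_atTop (1 + |q|)] with k hk
  have hk1 : 1 ≤ k := by linarith [abs_nonneg q]
  have hq : 0 ≤ k ^ 2 - q := by nlinarith [le_abs_self q]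
  have hs := Real.sqrt_nonneg (k ^ 2 - q)
  have key : (√(k ^ 2 - q) - k) * (√(k ^ 2 - q) + k) = -q := by
    linear_combination Real.sq_sqrt hq
  rw [le_div_iff₀ (by linarith), Real.norm_eq_abs]
  calc |√(k ^ 2 - q) - k| * k ≤ |√(k ^ 2 - q) - k| * |√(k ^ 2 - q) + k| := by
        refine mul_le_mul_of_nonneg_left ?_ (abs_nonneg _)
        rw [abs_of_nonneg (by linarith)]
        linarith
    _ = |q| := by rw [← abs_mul, key, abs_neg]

theorem tendsto_sqrt_sq_sub_div (q : ℝ) :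
    Tendsto (fun k : ℝ => √(k ^ 2 - q) / k) atTop (𝓝 1) := by
  have h : Tendsto (fun k : ℝ => (√(k ^ 2 - q) - k) / k + 1) atTop (𝓝 (0 + 1)) :=
    ((tendsto_sqrt_sq_sub_sub q).div_atTop tendsto_id).add tendsto_const_nhds
  rw [zero_add] at h
  refine h.congr' ?_
  filter_upwards [eventually_gt_atTop 0] with k hk
  field_simp
  ring

/-- The phase at the end of an edge of length `ℓ` with potential `q` for the energy `k ^ 2`, shifted
by the multiple `m` of `2 π`. -/
noncomputable def shiftedPhase (q ℓ : ℝ) (m : ℤ) (k : ℝ) : ℝ :=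
  √(k ^ 2 - q) * ℓ - m * (2 * Real.pi)

theorem cos_shiftedPhase (q ℓ : ℝ) (m : ℤ) (k : ℝ) :
    Real.cos (shiftedPhase q ℓ m k) = Real.cos (√(k ^ 2 - q) * ℓ) :=
  Real.cos_sub_int_mul_two_pi _ _

theorem sin_shiftedPhase (q ℓ : ℝ) (m : ℤ) (k : ℝ) :
    Real.sin (shiftedPhase q ℓ m k) = Real.sin (√(k ^ 2 - q) * ℓ) :=
  Real.sin_sub_int_mul_two_pi _ _

theorem continuous_shiftedPhase (q ℓ : ℝ) (m : ℤ) : Continuous (shiftedPhase q ℓ m) := by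
  unfold shiftedPhase
  fun_prop

theorem shiftedPhase_mono {q ℓ : ℝ} (hℓ : 0 ≤ ℓ) (m : ℤ) {k k' : ℝ} (hk : 0 ≤ k) (hkk : k ≤ k') :
    shiftedPhase q ℓ m k ≤ shiftedPhase q ℓ m k' := by
  unfold shiftedPhase
  gcongr

theorem tendsto_shiftedPhase {q ℓ : ℝ} {t : ℕ → ℝ} {m : ℕ → ℤ} (ht : Tendsto t atTop atTop)
    (hm : Tendsto (fun n => t n * ℓ - m n * (2 * Real.pi)) atTop (𝓝 0)) (δ : ℝ) :
    Tendsto (fun n => shiftedPhase q ℓ (m n) (t n + δ)) atTop (𝓝 (δ * ℓ)) := by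
  have h1 := (tendsto_sqrt_sq_sub_sub q).comp (tendsto_atTop_add_const_right _ δ ht)
  have h2 := ((h1.mul_const ℓ).add hm).add_const (δ * ℓ)
  rw [zero_mul, zero_add, zero_add] at h2
  refine h2.congr fun n => ?_
  simp only [shiftedPhase, Function.comp_apply]
  ring

theorem exists_strictMono_of_forall_exists_gt {P : ℝ → Prop} (h : ∀ K, ∃ x, K < x ∧ P x) :
    ∃ u : ℕ → ℝ, StrictMono u ∧ ∀ n, P (u n) := by
  choose f hf hP using h
  -- The shift to `n + 1` skips the starting point `0`, which need not satisfy `P`.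
  refine ⟨fun n => f^[n + 1] 0, strictMono_nat_of_lt_succ fun n => ?_, fun n => ?_⟩
  · rw [Function.iterate_succ_apply' f (n + 1)]
    exact hf _
  · simp only [Function.iterate_succ_apply']
    exact hP _

end Recurrence

/-! ### Propagation along edges of a connected graph -/

namespace MetricGraph

variable {V E : Type*} {G : MetricGraph V E}

theorem Connected.forall_mem (hG : G.Connected) {Z : Set V}
    (hZ : ∀ e, G.init e ∈ Z ↔ G.term e ∈ Z) {v : V} (hv : v ∈ Z) (w : V) : w ∈ Z := by
  obtain ⟨p⟩ := hG.preconnected v w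
  induction p with
  | nil => exact hv
  | cons hadj _ ih =>
    refine ih ?_
    obtain ⟨-, ⟨e, rfl, rfl⟩ | ⟨e, rfl, rfl⟩⟩ := hadj
    · exact (hZ e).1 hv
    · exact (hZ e).2 hv

theorem Connected.eq_of_forall_edge (hG : G.Connected) {X : Type*} {f : V → X}
    (hf : ∀ e, f (G.init e) = f (G.term e)) (v w : V) : f w = f v :=
  hG.forall_mem (Z := {w | f w = f v}) (fun e => by simp [hf e]) (v := v) rfl w

end MetricGraph

/-! ### Trees and the rooted linear system -/

namespace MetricGraph

open Filter Topology

variable {V E : Type*} {G : MetricGraph V E}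

theorem IsTree.card_add_one [Fintype V] [Fintype E] (hG : G.IsTree) :
    Fintype.card E + 1 = Fintype.card V := by
  classical
  obtain ⟨hne, hinj, htree⟩ := hG
  rw [← htree.card_edgeFinset, SimpleGraph.edgeFinset_card]
  congr 1
  have hmem : ∀ e, s(G.init e, G.term e) ∈ G.toSimpleGraph.edgeSet := fun e =>
    ⟨hne e, Or.inl ⟨e, rfl, rfl⟩⟩
  refine Fintype.card_congr (Equiv.ofBijective (fun e => ⟨_, hmem e⟩)
    ⟨fun e e' h => hinj (congrArg Subtype.val h), ?_⟩)
  rintro ⟨x, hx⟩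
  induction x with
  | h v w =>
    have hx' : (∃ e, G.init e = v ∧ G.term e = w) ∨ ∃ e, G.init e = w ∧ G.term e = v := hx.2
    obtain ⟨e, rfl, rfl⟩ | ⟨e, rfl, rfl⟩ := hx'
    · exact ⟨e, rfl⟩
    · exact ⟨e, Subtype.ext Sym2.eq_swap⟩

/-- On a tree, every function on the edges is a difference function. -/
theorem IsTree.exists_sub_eq [Fintype V] [Fintype E] (hG : G.IsTree) (B : E → ℝ) :
    ∃ f : V → ℝ, ∀ e, f (G.term e) - f (G.init e) = B e := by
  have hc : G.Connected := hG.2.2.connected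
  obtain ⟨o⟩ := hc.nonempty
  -- Recording also the value at `o` removes the constants from the kernel, and both sides then have
  -- the same dimension because `card E + 1 = card V`.
  let D : (V → ℝ) →ₗ[ℝ] (E → ℝ) × ℝ :=
    { toFun := fun f => (fun e => f (G.term e) - f (G.init e), f o)
      map_add' := fun f g => by ext <;> simp; ring
      map_smul' := fun c f => by ext <;> simp; ring }
  have hinj : Function.Injective D := by
    rw [← LinearMap.ker_eq_bot, LinearMap.ker_eq_bot']
    intro f hf
    have h1 : ∀ e, f (G.init e) = f (G.term e) := fun e => by
      have := congrFun (congrArg Prod.fst hf) e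
      exact (sub_eq_zero.1 this).symm
    have h2 : f o = 0 := congrArg Prod.snd hf
    funext v
    rw [hc.eq_of_forall_edge h1 o v, h2, Pi.zero_apply]
  have hsurj : Function.Surjective D := by
    refine (LinearMap.injective_iff_surjective_of_finrank_eq_finrank ?_).1 hinj
    simp [hG.card_add_one]
  obtain ⟨f, hf⟩ := hsurj (B, 0)
  exact ⟨f, fun e => congrFun (congrArg Prod.fst hf) e⟩

/-- Summation by parts on the graph. It is used with a potential of `B`, which turns the right side
into a sum of squares, and with `f = 1`, which gives the total flux. -/
theorem sum_mul_trigFlux [Fintype V] [Fintype E] (r c s : E → ℝ) (a : V → ℝ) (B : E → ℝ)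
    (f : V → ℝ) :
    ∑ v, f v * G.trigFlux r c s a B v =
      ∑ e, r e * (f (G.term e) * (B e * c e - a (G.init e) * s e) - f (G.init e) * B e) := by
  classical
  simp only [trigFlux, Finset.mul_sum]
  rw [Finset.sum_comm]
  refine Finset.sum_congr rfl fun e _ => ?_
  simp only [mul_add, mul_ite, mul_zero, Finset.sum_add_distrib, Finset.sum_ite_eq,
    Finset.mem_univ, if_true]
  ring

theorem trigFlux_mul_left [Fintype E] (k : ℝ) (r c s : E → ℝ) (a : V → ℝ) (B : E → ℝ) (v : V) :
    G.trigFlux (fun e => k * r e) c s a B v = k * G.trigFlux r c s a B v := by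
  simp only [trigFlux, Finset.mul_sum]
  refine Finset.sum_congr rfl fun e _ => ?_
  split_ifs <;> ring

theorem trigFlux_add [Fintype E] (r c s : E → ℝ) (a a' : V → ℝ) (B B' : E → ℝ) (v : V) :
    G.trigFlux r c s (a + a') (B + B') v =
      G.trigFlux r c s a B v + G.trigFlux r c s a' B' v := by
  simp only [trigFlux, ← Finset.sum_add_distrib, Pi.add_apply]
  refine Finset.sum_congr rfl fun e _ => ?_
  split_ifs <;> ring

theorem trigFlux_smul [Fintype E] (r c s : E → ℝ) (d : ℝ) (a : V → ℝ) (B : E → ℝ) (v : V) :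
    G.trigFlux r c s (d • a) (d • B) v = d * G.trigFlux r c s a B v := by
  simp only [trigFlux, Finset.mul_sum, Pi.smul_apply, smul_eq_mul]
  refine Finset.sum_congr rfl fun e _ => ?_
  split_ifs <;> ring

section System

variable [Fintype V] [Fintype E]

open Classical in
variable (G) in
/-- The linear system for the coefficients `x = (a, B)` of trigonometric functions on the graph:
the edge conditions, the coupling conditions at all vertices but the root `o`, and the
normalization at the root. The parameters `p = (φ, r, β)` are phases, wave numbers and coupling
constants. -/
noncomputable def rootedSystem (o : V) (p : (E → ℝ) × (E → ℝ) × (V → ℝ)) :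
    ((V → ℝ) × (E → ℝ)) →L[ℝ] ((V → ℝ) × (E → ℝ)) :=
  LinearMap.toContinuousLinearMap
    { toFun := fun x =>
        (fun v => if v = o then x.1 o else
          G.trigFlux p.2.1 (fun e => Real.cos (p.1 e)) (fun e => Real.sin (p.1 e)) x.1 x.2 v -
            p.2.2 v * x.1 v,
        fun e => x.1 (G.term e) - (x.1 (G.init e) * Real.cos (p.1 e) + x.2 e * Real.sin (p.1 e)))
      map_add' := fun x y => by
        ext v
        · simp only [Prod.fst_add, Prod.snd_add, trigFlux_add, Pi.add_apply]
          split_ifs <;> ring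
        · simp only [Prod.fst_add, Prod.snd_add, Pi.add_apply]
          ring
      map_smul' := fun d x => by
        ext v
        · simp only [Prod.smul_fst, Prod.smul_snd, trigFlux_smul, Pi.smul_apply, smul_eq_mul,
            RingHom.id_apply]
          split_ifs <;> ring
        · simp only [Prod.smul_fst, Prod.smul_snd, Pi.smul_apply, smul_eq_mul, RingHom.id_apply]
          ring }

theorem rootedSystem_eq_iff (o : V) (p : (E → ℝ) × (E → ℝ) × (V → ℝ)) (x : (V → ℝ) × (E → ℝ))
    (d : ℝ) : open Classical in G.rootedSystem o p x = (Pi.single o d, 0) ↔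
      x.1 o = d ∧
      (∀ v, v ≠ o → G.trigFlux p.2.1 (fun e => Real.cos (p.1 e)) (fun e => Real.sin (p.1 e))
        x.1 x.2 v = p.2.2 v * x.1 v) ∧
      ∀ e, x.1 (G.term e) = x.1 (G.init e) * Real.cos (p.1 e) + x.2 e * Real.sin (p.1 e) := by
  classical
  rw [Prod.ext_iff, funext_iff, funext_iff, ← and_assoc]
  refine and_congr ⟨fun h => ⟨?_, fun v hv => ?_⟩, fun h v => ?_⟩
    (forall_congr' fun e => ?_)
  · simpa [rootedSystem] using h o
  · have := h v
    simp only [rootedSystem, LinearMap.coe_toContinuousLinearMap', LinearMap.coe_mk,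
      AddHom.coe_mk, if_neg hv, Pi.single_eq_of_ne hv] at this
    exact sub_eq_zero.1 this
  · by_cases hv : v = o
    · subst hv
      simpa [rootedSystem] using h.1
    · simp only [rootedSystem, LinearMap.coe_toContinuousLinearMap', LinearMap.coe_mk,
        AddHom.coe_mk, if_neg hv, Pi.single_eq_of_ne hv]
      exact sub_eq_zero.2 (h.2 v hv)
  · simp only [rootedSystem, LinearMap.coe_toContinuousLinearMap', LinearMap.coe_mk,
      AddHom.coe_mk, Pi.zero_apply]
    exact sub_eq_zero

theorem continuous_rootedSystem (o : V) : Continuous (G.rootedSystem o) := by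
  refine continuous_clm_apply.2 fun x => ?_
  refine Continuous.prodMk (continuous_pi fun v => ?_) (continuous_pi fun e => by fun_prop)
  split_ifs
  · fun_prop
  · refine Continuous.sub (continuous_finsetSum _ fun e _ => ?_) (by fun_prop)
    refine Continuous.add ?_ ?_
    · split_ifs <;> fun_prop
    · split_ifs <;> fun_prop

/-- At zero phases the edge conditions force `a` to be constant, hence zero by the normalization,
and the flux conditions make `B` a flow without sources, which vanishes on a tree. -/
theorem IsTree.isUnit_rootedSystem (hG : G.IsTree) (o : V) :
    IsUnit (G.rootedSystem o (0, 1, 0)) := by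
  classical
  have hc : G.Connected := hG.2.2.connected
  rw [ContinuousLinearMap.isUnit_iff_bijective]
  have hinj : Function.Injective (G.rootedSystem o (0, 1, 0)) := by
    refine (injective_iff_map_eq_zero _).2 fun x hx => ?_
    obtain ⟨ho, hflux, hedge⟩ := (rootedSystem_eq_iff o (0, 1, 0) x 0).1 (by
      rw [hx, Pi.single_zero]; rfl)
    simp only [Pi.zero_apply, Real.cos_zero, Real.sin_zero, mul_one, mul_zero, add_zero,
      zero_mul] at hflux hedge
    have ha : x.1 = 0 := by
      funext v
      rw [hc.eq_of_forall_edge (fun e => (hedge e).symm) o v, ho, Pi.zero_apply]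
    obtain ⟨f, hf⟩ := hG.exists_sub_eq x.2
    -- Subtracting `f o` gives the root, where no flux condition is available, the weight zero.
    have hsum := sum_mul_trigFlux (G := G) 1 (fun _ => 1) (fun _ => 0) x.1 x.2
      (fun v => f v - f o)
    rw [Finset.sum_eq_zero] at hsum
    · have hB : ∑ e, x.2 e ^ 2 = 0 := by
        rw [hsum]
        refine Finset.sum_congr rfl fun e _ => ?_
        rw [← hf e, Pi.one_apply]
        ring
      rw [Finset.sum_eq_zero_iff_of_nonneg fun e _ => sq_nonneg _] at hB
      refine Prod.ext ha (funext fun e => ?_)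
      simpa using hB e (Finset.mem_univ e)
    · intro v _
      by_cases hv : v = o
      · simp [hv]
      · rw [hflux v hv, mul_zero]
  exact ⟨hinj, LinearMap.injective_iff_surjective.1 hinj⟩

open Classical in
variable (G) in
/-- The solution of the linear system `rootedSystem` with value one at the root. -/
noncomputable def rootedSolution (o : V) (p : (E → ℝ) × (E → ℝ) × (V → ℝ)) :
    (V → ℝ) × (E → ℝ) :=
  Ring.inverse (G.rootedSystem o p) (Pi.single o 1, 0)

theorem rootedSystem_rootedSolution {o : V} {p : (E → ℝ) × (E → ℝ) × (V → ℝ)}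
    (hp : IsUnit (G.rootedSystem o p)) :
    open Classical in G.rootedSystem o p (G.rootedSolution o p) = (Pi.single o 1, 0) := by
  classical
  change (G.rootedSystem o p * Ring.inverse (G.rootedSystem o p)) (Pi.single o 1, 0) = _
  rw [Ring.mul_inverse_cancel _ hp]
  rfl

theorem continuousAt_rootedSolution {o : V} {p : (E → ℝ) × (E → ℝ) × (V → ℝ)}
    (hp : IsUnit (G.rootedSystem o p)) : ContinuousAt (G.rootedSolution o) p := by
  obtain ⟨u, hu⟩ := hp
  have h1 : ContinuousAt (fun p => Ring.inverse (G.rootedSystem o p)) p := by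
    refine ContinuousAt.comp (g := Ring.inverse) ?_ (continuous_rootedSystem o).continuousAt
    rw [← hu]
    exact NormedRing.inverse_continuousAt u
  exact h1.clm_apply continuousAt_const

theorem IsTree.rootedSolution_zero (hG : G.IsTree) (o : V) :
    G.rootedSolution o (0, 1, 0) = (1, 0) := by
  have hu := hG.isUnit_rootedSystem o
  refine ((ContinuousLinearMap.isUnit_iff_bijective).1 hu).1 ?_
  rw [rootedSystem_rootedSolution hu]
  symm
  rw [rootedSystem_eq_iff]
  refine ⟨rfl, fun v _ => ?_, fun e => ?_⟩
  · simp [trigFlux]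
  · simp

/-- Invertibility is an open condition and inversion is continuous, so the solution stays near its
value `(1, 0)` at the unperturbed parameters. -/
theorem IsTree.exists_rootedSolution_near (hG : G.IsTree) (o : V) :
    ∃ η > 0, ∀ p : (E → ℝ) × (E → ℝ) × (V → ℝ), (∀ e, |p.1 e| < η) → (∀ e, |p.2.1 e - 1| < η) →
      (∀ v, |p.2.2 v| < η) → IsUnit (G.rootedSystem o p) ∧
        (∀ v, 1 / 2 < (G.rootedSolution o p).1 v) ∧ ∀ e, |(G.rootedSolution o p).2 e| < 1 := by
  have hu := hG.isUnit_rootedSystem o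
  have hcont := continuousAt_rootedSolution hu
  have h1 : ∀ᶠ p in 𝓝 ((0, 1, 0) : (E → ℝ) × (E → ℝ) × (V → ℝ)), IsUnit (G.rootedSystem o p) :=
    (continuous_rootedSystem o).continuousAt.eventually (Units.isOpen.mem_nhds hu)
  have h2 : ∀ᶠ p in 𝓝 ((0, 1, 0) : (E → ℝ) × (E → ℝ) × (V → ℝ)),
      ∀ v, 1 / 2 < (G.rootedSolution o p).1 v := by
    refine eventually_all.2 fun v => ?_
    refine Filter.Tendsto.eventually_const_lt ?_
      ((continuous_apply v).continuousAt.comp (continuous_fst.continuousAt.comp hcont))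
    simp only [Function.comp_apply, hG.rootedSolution_zero, Pi.one_apply]
    norm_num
  have h3 : ∀ᶠ p in 𝓝 ((0, 1, 0) : (E → ℝ) × (E → ℝ) × (V → ℝ)),
      ∀ e, |(G.rootedSolution o p).2 e| < 1 := by
    refine eventually_all.2 fun e => ?_
    refine Filter.Tendsto.eventually_lt_const ?_
      ((continuous_apply e).continuousAt.comp (continuous_snd.continuousAt.comp hcont)).abs
    simp [hG.rootedSolution_zero]
  obtain ⟨η, hη, h⟩ := Metric.eventually_nhds_iff.1 (h1.and (h2.and h3))
  refine ⟨η, hη, fun p hφ hr hβ => h ?_⟩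
  rw [Prod.dist_eq, Prod.dist_eq]
  refine max_lt ((dist_pi_lt_iff hη).2 fun e => ?_) (max_lt ((dist_pi_lt_iff hη).2 fun e => ?_)
    ((dist_pi_lt_iff hη).2 fun v => ?_))
  · simpa [Real.dist_eq] using hφ e
  · simpa [Real.dist_eq] using hr e
  · simpa [Real.dist_eq] using hβ v

variable (G) in
/-- The defect of the coupling condition at the root for `rootedSolution`. -/
noncomputable def rootDefect (o : V) (p : (E → ℝ) × (E → ℝ) × (V → ℝ)) : ℝ :=
  ∑ e, p.2.1 e * ((G.rootedSolution o p).2 e * (Real.cos (p.1 e) - 1) -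
    (G.rootedSolution o p).1 (G.init e) * Real.sin (p.1 e)) -
    ∑ v, p.2.2 v * (G.rootedSolution o p).1 v

/-- The defect is the sum of the coupling defects over all vertices. All but the one at the root
vanish by construction, so a zero sum gives the root condition. -/
theorem trigFlux_rootedSolution {o : V} {p : (E → ℝ) × (E → ℝ) × (V → ℝ)}
    (hp : IsUnit (G.rootedSystem o p)) (h0 : G.rootDefect o p = 0) (v : V) :
    G.trigFlux p.2.1 (fun e => Real.cos (p.1 e)) (fun e => Real.sin (p.1 e))
      (G.rootedSolution o p).1 (G.rootedSolution o p).2 v =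
        p.2.2 v * (G.rootedSolution o p).1 v := by
  classical
  obtain ⟨-, hflux, -⟩ := (rootedSystem_eq_iff o p _ 1).1 (rootedSystem_rootedSolution hp)
  by_cases hv : v = o
  · have hsum := sum_mul_trigFlux (G := G) p.2.1 (fun e => Real.cos (p.1 e))
      (fun e => Real.sin (p.1 e)) (G.rootedSolution o p).1 (G.rootedSolution o p).2 (fun _ => 1)
    rw [rootDefect, sub_eq_zero] at h0
    simp only [one_mul] at hsum
    have h1 : ∑ v, G.trigFlux p.2.1 (fun e => Real.cos (p.1 e)) (fun e => Real.sin (p.1 e))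
        (G.rootedSolution o p).1 (G.rootedSolution o p).2 v =
        ∑ v, p.2.2 v * (G.rootedSolution o p).1 v := by
      rw [hsum, ← h0]
      refine Finset.sum_congr rfl fun e _ => ?_
      ring
    rw [← Finset.add_sum_erase _ _ (Finset.mem_univ v),
      ← Finset.add_sum_erase Finset.univ (fun v => p.2.2 v * (G.rootedSolution o p).1 v)
        (Finset.mem_univ v)] at h1
    rw [Finset.sum_congr rfl fun w hw => hflux w (hv ▸ Finset.ne_of_mem_erase hw)] at h1
    exact add_right_cancel h1
  · exact hflux v hv

theorem continuousAt_rootDefect {o : V} {p : (E → ℝ) × (E → ℝ) × (V → ℝ)}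
    (hp : IsUnit (G.rootedSystem o p)) : ContinuousAt (G.rootDefect o) p := by
  have h := continuousAt_rootedSolution hp
  have ha : ∀ v, ContinuousAt (fun p => (G.rootedSolution o p).1 v) p := fun v =>
    (continuous_apply v).continuousAt.comp (continuous_fst.continuousAt.comp h)
  have hB : ∀ e, ContinuousAt (fun p => (G.rootedSolution o p).2 e) p := fun e =>
    (continuous_apply e).continuousAt.comp (continuous_snd.continuousAt.comp h)
  unfold rootDefect
  fun_prop

end System

end MetricGraph

/-! ### Simple eigenvalues of trees -/

namespace MetricGraph

open Filter Topology

variable {V E : Type*} {G : MetricGraph V E}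

/-- The term with `B` is quadratically small, as `1 - cos φ ≤ sin φ ^ 2`, whereas `a * sin φ` is of
first order. The bounds `|sin φ| < 1 / 2 < a` make the latter dominate. -/
theorem mul_sin_neg {φ a B : ℝ} (hφ : |φ| < 1 / 2) (hφ0 : φ ≠ 0) (ha : 1 / 2 < a) (hB : |B| < 1) :
    (B * (Real.cos φ - 1) - a * Real.sin φ) * Real.sin φ < 0 := by
  have hpi := Real.pi_gt_three
  have hs : |Real.sin φ| < 1 / 2 := Real.abs_sin_le_abs.trans_lt hφ
  obtain ⟨h1, h2⟩ := abs_lt.1 hφ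
  have hs0 : Real.sin φ ≠ 0 := by
    rw [Ne, Real.sin_eq_zero_iff_of_lt_of_lt (by linarith) (by linarith)]
    exact hφ0
  have hc : 0 ≤ Real.cos φ := Real.cos_nonneg_of_neg_pi_div_two_le_of_le (by linarith) (by linarith)
  have hc1 := Real.cos_le_one φ
  have hsc := Real.sin_sq_add_cos_sq φ
  have hle : 1 - Real.cos φ ≤ Real.sin φ ^ 2 := by nlinarith
  have hpos : 0 < Real.sin φ ^ 2 := by positivity
  have h3 : B * (Real.cos φ - 1) * Real.sin φ ≤ Real.sin φ ^ 2 * |Real.sin φ| := by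
    refine (le_abs_self _).trans ?_
    rw [abs_mul, abs_mul]
    refine mul_le_mul_of_nonneg_right ?_ (abs_nonneg _)
    rw [abs_sub_comm, abs_of_nonneg (sub_nonneg.2 hc1)]
    exact (mul_le_of_le_one_left (sub_nonneg.2 hc1) hB.le).trans hle
  nlinarith

section Tree

variable [Fintype V] [Fintype E]

variable (G) in
/-- The parameters of the linear system `rootedSystem` that correspond to the energy `k ^ 2`. -/
noncomputable def energyParam (α : V → ℝ) (q : E → ℝ) (m : E → ℤ) (k : ℝ) :
    (E → ℝ) × (E → ℝ) × (V → ℝ) :=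
  (fun e => shiftedPhase (q e) (G.len e) (m e) k, fun e => √(k ^ 2 - q e) / k, fun v => α v / k)

theorem simple_of_rootDefect_eq_zero [Nonempty E] {α : V → ℝ} {q : E → ℝ}
    {m : E → ℤ} {k : ℝ} (hk : 0 < k) (hq : ∀ e, q e < k ^ 2) {o : V}
    (hu : IsUnit (G.rootedSystem o (G.energyParam α q m k)))
    (ha : ∀ v, (G.rootedSolution o (G.energyParam α q m k)).1 v ≠ 0)
    (h0 : G.rootDefect o (G.energyParam α q m k) = 0) :
    Module.finrank ℝ (G.eigenspace ∅ α q (k ^ 2)) = 1 ∧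
      ∃ ψ, G.IsEigenfunction ∅ α q (k ^ 2) ψ ∧ ∀ v, G.NonvanishingAt ψ v := by
  set x := G.rootedSolution o (G.energyParam α q m k) with hx
  set κ : E → ℝ := fun e => √(k ^ 2 - q e) with hκ
  have hκ2 : ∀ e, κ e ^ 2 = k ^ 2 - q e := fun e => Real.sq_sqrt (sub_nonneg.2 (hq e).le)
  have hκ0 : ∀ e, κ e ≠ 0 := fun e => (Real.sqrt_pos.2 (sub_pos.2 (hq e))).ne'
  have hflux : ∀ v (a : V → ℝ) (B : E → ℝ),
      G.trigFlux κ (fun e => Real.cos (κ e * G.len e)) (fun e => Real.sin (κ e * G.len e)) a B v =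
      k * G.trigFlux (G.energyParam α q m k).2.1
        (fun e => Real.cos ((G.energyParam α q m k).1 e))
        (fun e => Real.sin ((G.energyParam α q m k).1 e)) a B v := by
    intro v a B
    rw [← trigFlux_mul_left]
    simp only [energyParam, cos_shiftedPhase, sin_shiftedPhase, mul_div_cancel₀ _ hk.ne', hκ]
  obtain ⟨-, -, hedge⟩ := (rootedSystem_eq_iff o _ _ 1).1 (rootedSystem_rootedSolution hu)
  rw [← hx] at hedge
  have hmem : G.trigFun κ x.1 x.2 ∈ G.eigenspace ∅ α q (k ^ 2) := by
    refine trigFun_mem_eigenspace G hκ2 (by simp) (fun e => ?_) fun v _ => ?_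
    · rw [hedge e]
      simp only [energyParam, cos_shiftedPhase, sin_shiftedPhase, hκ]
    · rw [hflux, trigFlux_rootedSolution hu h0, ← hx, ← mul_assoc]
      exact congrArg (· * x.1 v) (mul_div_cancel₀ _ hk.ne')
  have hinit : ∀ e, G.trigFun κ x.1 x.2 e (G.initPt e) = x.1 (G.init e) := by
    simp [trigFun, initPt]
  have hne : G.trigFun κ x.1 x.2 ≠ 0 := by
    obtain ⟨e⟩ := ‹Nonempty E›
    intro h
    refine ha (G.init e) ?_
    rw [← hinit e, h]
    rfl
  refine ⟨?_, G.trigFun κ x.1 x.2, ⟨hmem, hne⟩, fun v => ⟨fun e he => ?_, fun e he => ?_⟩⟩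
  · rw [finrank_eq_one_iff']
    refine ⟨⟨_, hmem⟩, fun h => hne (congrArg Subtype.val h), ?_⟩
    rintro ⟨ψ, hψ⟩
    obtain ⟨a, B, rfl, hedge', hflux'⟩ := exists_eq_trigFun_of_mem_eigenspace G hκ2 hκ0 hψ
    refine ⟨a o, Subtype.ext ?_⟩
    -- Every eigenfunction solves the rooted system with its own root value, so injectivity makes it
    -- that multiple of the normalized solution.
    have hsys : G.rootedSystem o (G.energyParam α q m k) (a, B) =
        G.rootedSystem o (G.energyParam α q m k) (a o • x) := by
      classical
      have h1 : G.rootedSystem o (G.energyParam α q m k) (a, B) = (Pi.single o (a o), 0) := by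
        rw [rootedSystem_eq_iff]
        refine ⟨rfl, fun v _ => mul_left_cancel₀ hk.ne' ?_, fun e => ?_⟩
        · rw [← hflux, hflux', energyParam, ← mul_assoc, mul_div_cancel₀ _ hk.ne']
        · refine (hedge' e).trans ?_
          simp only [energyParam, cos_shiftedPhase, sin_shiftedPhase, hκ]
      have h2 := rootedSystem_rootedSolution hu
      rw [h1, map_smul, h2, Prod.smul_mk, smul_zero, ← Pi.single_smul, smul_eq_mul, mul_one]
    have heq := ((ContinuousLinearMap.isUnit_iff_bijective).1 hu).1 hsys
    have h1 : a = a o • x.1 := congrArg Prod.fst heq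
    have h2 : B = a o • x.2 := congrArg Prod.snd heq
    funext e y
    have h3 := congrFun h1 (G.init e)
    have h4 := congrFun h2 e
    simp only [Pi.smul_apply, smul_eq_mul] at h3 h4
    simp only [trigFun, Submodule.coe_smul, Pi.smul_apply, smul_eq_mul]
    rw [h3, h4]
    ring
  · rw [hinit, he]
    exact ha v
  · have : G.trigFun κ x.1 x.2 e (G.termPt e) = x.1 (G.term e) := by
      rw [hedge e]
      simp only [trigFun, termPt, energyParam, cos_shiftedPhase, sin_shiftedPhase, hκ]
    rw [this, he]
    exact ha v

/-- On a tree, there are arbitrarily large simple eigenvalues with an eigenfunction that does not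
vanish at any vertex. -/
theorem IsTree.exists_gt_simple [Nonempty E] (hG : G.IsTree) (α : V → ℝ) (q : E → ℝ) (K : ℝ) :
    ∃ lam, K < lam ∧ Module.finrank ℝ (G.eigenspace ∅ α q lam) = 1 ∧
      ∃ ψ, G.IsEigenfunction ∅ α q lam ψ ∧ ∀ v, G.NonvanishingAt ψ v := by
  have hc : G.Connected := hG.2.2.connected
  obtain ⟨o⟩ := hc.nonempty
  obtain ⟨η, hη, hgood⟩ := hG.exists_rootedSolution_near o
  obtain ⟨t, m, ht, hm⟩ := exists_tendsto_mul_sub_int_mul_two_pi G.len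
  -- The bound `η` keeps the limit parameters where the rooted system is controlled; `1 / 2` is what
  -- `mul_sin_neg` requires.
  obtain ⟨δ, hδ, hδℓ⟩ : ∃ δ > 0, ∀ e, δ * G.len e < min η (1 / 2) := by
    have hev : ∀ᶠ δ in 𝓝[>] (0 : ℝ), ∀ e, δ * G.len e < min η (1 / 2) := by
      refine eventually_all.2 fun e => nhdsWithin_le_nhds ?_
      refine Tendsto.eventually_lt_const (v := 0 * G.len e) ?_
        (Continuous.tendsto (by fun_prop) 0)
      rw [zero_mul]
      positivity
    obtain ⟨δ, h1, h2⟩ := (hev.and self_mem_nhdsWithin).exists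
    exact ⟨δ, h2, h1⟩
  have hδℓ0 : ∀ e, 0 < δ * G.len e := fun e => mul_pos hδ (G.len_pos e)
  have hδη : ∀ e, δ * G.len e < η := fun e => (hδℓ e).trans_le (min_le_left _ _)
  have hδ2 : ∀ e, δ * G.len e < 1 / 2 := fun e => (hδℓ e).trans_le (min_le_right _ _)
  have hlim : ∀ d, Tendsto (fun n => G.energyParam α q (m n) (t n + d)) atTop
      (𝓝 (fun e => d * G.len e, 1, 0)) := by
    intro d
    have htd := tendsto_atTop_add_const_right _ d ht
    refine Tendsto.prodMk_nhds (tendsto_pi_nhds.2 fun e => tendsto_shiftedPhase ht (hm e) d)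
      (Tendsto.prodMk_nhds (tendsto_pi_nhds.2 fun e => ?_) (tendsto_pi_nhds.2 fun v => ?_))
    · exact (tendsto_sqrt_sq_sub_div (q e)).comp htd
    · exact tendsto_const_nhds.div_atTop htd
  have hgoodlim : ∀ d, |d| = δ → _ := fun d hd => hgood (fun e => d * G.len e, 1, 0)
    (fun e => by
      simp only [abs_mul, abs_of_pos (G.len_pos e), hd]
      exact hδη e)
    (by simpa using hη) (by simpa using fun _ => hη)
  have hsin : ∀ d, |d| = δ → ∀ e, ((G.rootedSolution o (fun e => d * G.len e, 1, 0)).2 e *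
      (Real.cos (d * G.len e) - 1) - (G.rootedSolution o (fun e => d * G.len e, 1, 0)).1
        (G.init e) * Real.sin (d * G.len e)) * Real.sin (d * G.len e) < 0 := by
    intro d hd e
    refine mul_sin_neg ?_ ?_ ((hgoodlim d hd).2.1 _) ((hgoodlim d hd).2.2 e)
    · rw [abs_mul, abs_of_pos (G.len_pos e), hd]
      exact hδ2 e
    · refine mul_ne_zero ?_ (G.len_pos e).ne'
      rw [← abs_pos, hd]
      exact hδ
  have hsinpos : ∀ e, 0 < Real.sin (δ * G.len e) := fun e =>
    Real.sin_pos_of_pos_of_lt_pi (hδℓ0 e) (by linarith [hδ2 e, Real.pi_gt_three])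
  have hneg : G.rootDefect o (fun e => δ * G.len e, 1, 0) < 0 := by
    simp only [rootDefect, Pi.one_apply, Pi.zero_apply, zero_mul, Finset.sum_const_zero, sub_zero,
      one_mul]
    refine Finset.sum_neg (fun e _ => ?_) Finset.univ_nonempty
    exact neg_of_mul_neg_left (hsin δ (abs_of_pos hδ) e) (hsinpos e).le
  have hpos : 0 < G.rootDefect o (fun e => -δ * G.len e, 1, 0) := by
    simp only [rootDefect, Pi.one_apply, Pi.zero_apply, zero_mul, Finset.sum_const_zero, sub_zero,
      one_mul]
    refine Finset.sum_pos (fun e _ => ?_) Finset.univ_nonempty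
    refine pos_of_mul_neg_left (hsin (-δ) (by rw [abs_neg, abs_of_pos hδ]) e) ?_
    rw [neg_mul, Real.sin_neg]
    exact neg_nonpos.2 (hsinpos e).le
  have e1 : ∀ᶠ n in atTop, G.rootDefect o (G.energyParam α q (m n) (t n + δ)) < 0 :=
    ((continuousAt_rootDefect (hgoodlim δ (abs_of_pos hδ)).1).tendsto.comp
      (hlim δ)).eventually_lt_const hneg
  have e2 : ∀ᶠ n in atTop, 0 < G.rootDefect o (G.energyParam α q (m n) (t n + -δ)) :=
    ((continuousAt_rootDefect (hgoodlim (-δ) (by rw [abs_neg, abs_of_pos hδ])).1).tendsto.comp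
      (hlim (-δ))).eventually_const_lt hpos
  have e3 : ∀ᶠ n in atTop, ∀ e, shiftedPhase (q e) (G.len e) (m n e) (t n + δ) < η :=
    eventually_all.2 fun e => (tendsto_shiftedPhase ht (hm e) δ).eventually_lt_const (hδη e)
  have e4 : ∀ᶠ n in atTop, ∀ e, -η < shiftedPhase (q e) (G.len e) (m n e) (t n + -δ) :=
    eventually_all.2 fun e => (tendsto_shiftedPhase ht (hm e) (-δ)).eventually_const_lt
      (by linarith [hδη e])
  have hk : ∀ᶠ k : ℝ in atTop, 0 < k ∧ K < k ^ 2 ∧ (∀ e, q e < k ^ 2) ∧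
      (∀ e, |√(k ^ 2 - q e) / k - 1| < η) ∧ ∀ v, |α v / k| < η := by
    have hsq : Tendsto (fun k : ℝ => k ^ 2) atTop atTop := tendsto_pow_atTop two_ne_zero
    refine (eventually_gt_atTop 0).and ((hsq.eventually_gt_atTop K).and
      ((eventually_all.2 fun e => hsq.eventually_gt_atTop (q e)).and
        ((eventually_all.2 fun e => ?_).and (eventually_all.2 fun v => ?_))))
    · have := (Metric.tendsto_nhds.1 (tendsto_sqrt_sq_sub_div (q e))) η hη
      simpa only [Real.dist_eq] using this
    · have h : Tendsto (fun k : ℝ => α v / k) atTop (𝓝 0) := tendsto_const_nhds.div_atTop tendsto_id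
      have := (Metric.tendsto_nhds.1 h) η hη
      simpa only [Real.dist_eq, sub_zero] using this
  obtain ⟨K', hK'⟩ := eventually_atTop.1 hk
  have e5 := (tendsto_atTop_add_const_right _ (-δ) ht).eventually_ge_atTop K'
  obtain ⟨n, h1, h2, h3, h4, h5⟩ := (e1.and (e2.and (e3.and (e4.and e5)))).exists
  -- The phases are monotone in `k`, so their bounds at the two ends of the interval hold
  -- throughout.
  have hall : ∀ k ∈ Set.Icc (t n + -δ) (t n + δ), _ := fun k hk' =>
    hgood (G.energyParam α q (m n) k)
      (fun e => abs_lt.2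
        ⟨(h4 e).trans_le (shiftedPhase_mono (G.len_pos e).le _ (hK' _ h5).1.le hk'.1),
          (shiftedPhase_mono (G.len_pos e).le _ ((hK' _ h5).1.le.trans hk'.1) hk'.2).trans_lt
            (h3 e)⟩)
      (hK' k (h5.trans hk'.1)).2.2.2.1 (hK' k (h5.trans hk'.1)).2.2.2.2
  have hcont : ContinuousOn (fun k => G.rootDefect o (G.energyParam α q (m n) k))
      (Set.Icc (t n + -δ) (t n + δ)) := by
    intro k hk'
    refine ContinuousAt.continuousWithinAt ?_
    refine ContinuousAt.comp (continuousAt_rootDefect (hall k hk').1) ?_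
    have hk0 : k ≠ 0 := (hK' k (h5.trans hk'.1)).1.ne'
    refine ContinuousAt.prodMk (continuousAt_pi.2 fun e =>
      (continuous_shiftedPhase _ _ _).continuousAt)
      (ContinuousAt.prodMk (continuousAt_pi.2 fun e => ?_) (continuousAt_pi.2 fun v => ?_))
    · exact ContinuousAt.div (by fun_prop) continuousAt_id hk0
    · exact ContinuousAt.div continuousAt_const continuousAt_id hk0
  obtain ⟨k, hk', h0⟩ := intermediate_value_Icc' (by linarith) hcont
    (Set.mem_Icc.2 ⟨h1.le, h2.le⟩)
  obtain ⟨k0, kK, kq, -, -⟩ := hK' k (h5.trans hk'.1)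
  exact ⟨k ^ 2, kK, simple_of_rootDefect_eq_zero k0 kq (hall k hk').1
    (fun v => ((hall k hk').2.1 v |>.trans' (by norm_num)).ne') h0⟩

end Tree

end MetricGraph

namespace MetricGraph

open Filter Topology

variable {V E : Type*} {G : MetricGraph V E}

/-! ### Vertices of degree one -/

section Degree

theorem subsingleton_ends [Finite E] {v : V} (hv : G.degree v = 1) :
    Subsingleton ({e : E // G.init e = v} ⊕ {e : E // G.term e = v}) := by
  rw [← Finite.card_le_one_iff_subsingleton, Nat.card_sum]
  exact hv.le

theorem eq_of_init_eq [Finite E] {e e' : E} (hv : G.degree (G.init e) = 1)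
    (h : G.init e' = G.init e) : e' = e := by
  have := subsingleton_ends hv
  simpa using Subsingleton.elim (α := {x : E // G.init x = G.init e} ⊕ {x : E // G.term x = G.init e})
    (Sum.inl ⟨e', h⟩) (Sum.inl ⟨e, rfl⟩)

theorem eq_of_term_eq [Finite E] {e e' : E} (hv : G.degree (G.term e) = 1)
    (h : G.term e' = G.term e) : e' = e := by
  have := subsingleton_ends hv
  simpa using Subsingleton.elim (α := {x : E // G.init x = G.term e} ⊕ {x : E // G.term x = G.term e})
    (Sum.inr ⟨e', h⟩) (Sum.inr ⟨e, rfl⟩)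

theorem init_ne_term_of_degree_eq_one [Finite E] {v : V} (hv : G.degree v = 1) {e e' : E}
    (h : G.init e = v) : G.term e' ≠ v := by
  intro h'
  have := subsingleton_ends hv
  simpa using Subsingleton.elim (α := {x : E // G.init x = v} ⊕ {x : E // G.term x = v})
    (Sum.inl ⟨e, h⟩) (Sum.inr ⟨e', h'⟩)

/-- A connected graph with an edge between two vertices of degree one has no other edge. -/
theorem Connected.subsingleton_of_degree_eq_one [Finite E] (hG : G.Connected) {e : E}
    (hi : G.degree (G.init e) = 1) (ht : G.degree (G.term e) = 1) : Subsingleton E := by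
  have hall : ∀ w, w = G.init e ∨ w = G.term e := by
    refine hG.forall_mem (Z := {w | w = G.init e ∨ w = G.term e}) (fun e' => ?_)
      (v := G.init e) (Or.inl rfl)
    constructor
    · rintro (h | h)
      · rw [eq_of_init_eq hi h]
        exact Or.inr rfl
      · exact absurd rfl (init_ne_term_of_degree_eq_one ht h (e' := e))
    · rintro (h | h)
      · exact absurd h (init_ne_term_of_degree_eq_one hi rfl)
      · rw [eq_of_term_eq ht h]
        exact Or.inl rfl
  have heq : ∀ e', e' = e := fun e' => by
    obtain h | h := hall (G.init e')
    · exact eq_of_init_eq hi h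
    · exact absurd rfl (init_ne_term_of_degree_eq_one ht h (e' := e))
  exact ⟨fun a b => (heq a).trans (heq b).symm⟩

end Degree

/-! ### The vertex form, its first degeneracy and positivity of null vectors -/

section Form

variable [Fintype V] [Fintype E]

variable (G) in
/-- The bilinear form on vertex functions with edge coefficients `c.1` (diagonal) and `c.2.1`
(off-diagonal) and vertex coefficients `c.2.2`. -/
noncomputable def vertexForm (c : (E → ℝ) × (E → ℝ) × (V → ℝ)) (x y : V → ℝ) : ℝ :=
  ∑ e, (c.1 e * (x (G.init e) * y (G.init e) + x (G.term e) * y (G.term e)) -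
    c.2.1 e * (x (G.init e) * y (G.term e) + x (G.term e) * y (G.init e))) -
    ∑ v, c.2.2 v * (x v * y v)

theorem continuous_vertexForm :
    Continuous fun z : ((E → ℝ) × (E → ℝ) × (V → ℝ)) × (V → ℝ) => G.vertexForm z.1 z.2 z.2 := by
  unfold vertexForm
  fun_prop

theorem vertexForm_smul_left (d : ℝ) (c : (E → ℝ) × (E → ℝ) × (V → ℝ)) (x y : V → ℝ) :
    G.vertexForm (d • c) x y = d * G.vertexForm c x y := by
  simp only [vertexForm, Prod.smul_fst, Prod.smul_snd, Pi.smul_apply, smul_eq_mul, mul_sub,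
    Finset.mul_sum, mul_assoc]

theorem vertexForm_smul_self (d : ℝ) (c : (E → ℝ) × (E → ℝ) × (V → ℝ)) (x : V → ℝ) :
    G.vertexForm c (d • x) (d • x) = d ^ 2 * G.vertexForm c x x := by
  simp only [vertexForm, Pi.smul_apply, smul_eq_mul, mul_sub, Finset.mul_sum]
  congr 1 <;> refine Finset.sum_congr rfl fun _ _ => ?_ <;> ring

theorem vertexForm_add_smul_self (d : ℝ) (c : (E → ℝ) × (E → ℝ) × (V → ℝ)) (x y : V → ℝ) :
    G.vertexForm c (x + d • y) (x + d • y) =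
      G.vertexForm c x x + 2 * d * G.vertexForm c x y + d ^ 2 * G.vertexForm c y y := by
  simp only [vertexForm, Pi.add_apply, Pi.smul_apply, smul_eq_mul, mul_sub, Finset.mul_sum]
  rw [show ∀ a b a' b' a'' b'' : ℝ, a - b + (a' - b') + (a'' - b'') =
    (a + a' + a'') - (b + b' + b'') by intros; ring, ← Finset.sum_add_distrib,
    ← Finset.sum_add_distrib, ← Finset.sum_add_distrib, ← Finset.sum_add_distrib]
  congr 1 <;> refine Finset.sum_congr rfl fun _ _ => ?_ <;> ring

open Classical in
theorem vertexForm_single (c : (E → ℝ) × (E → ℝ) × (V → ℝ)) (x : V → ℝ) (v : V) :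
    G.vertexForm c x (Pi.single v 1) =
      ∑ e, ((if G.init e = v then c.1 e * x (G.init e) - c.2.1 e * x (G.term e) else 0) +
        (if G.term e = v then c.1 e * x (G.term e) - c.2.1 e * x (G.init e) else 0)) -
        c.2.2 v * x v := by
  simp only [vertexForm, Pi.single_apply, mul_ite, mul_one, mul_zero, Finset.sum_ite_eq',
    Finset.mem_univ, if_true]
  congr 1
  refine Finset.sum_congr rfl fun _ _ => ?_
  split_ifs <;> ring

/-- The normalized vertex functions that vanish on `VD`. -/
def dirichletSphere (VD : Set V) : Set (V → ℝ) := {x | (∀ v ∈ VD, x v = 0) ∧ ‖x‖ = 1}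

theorem isCompact_dirichletSphere (VD : Set V) : IsCompact (dirichletSphere VD) := by
  refine (isCompact_sphere (0 : V → ℝ) 1).of_isClosed_subset ?_ fun x hx => by simpa using hx.2
  have h : dirichletSphere VD = (⋂ v ∈ VD, {x : V → ℝ | x v = 0}) ∩ {x | ‖x‖ = 1} := by
    ext x
    simp [dirichletSphere]
  rw [h]
  exact (isClosed_biInter fun v _ => isClosed_eq (continuous_apply v) continuous_const).inter
    (isClosed_eq continuous_norm continuous_const)

/-- Compactness of the sphere makes definiteness an open condition on the coefficients. -/
theorem eventually_vertexForm_pos {VD : Set V} {c₀ : (E → ℝ) × (E → ℝ) × (V → ℝ)}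
    (h : ∀ x ∈ dirichletSphere VD, 0 < G.vertexForm c₀ x x) :
    ∀ᶠ c in 𝓝 c₀, ∀ x ∈ dirichletSphere VD, 0 < G.vertexForm c x x :=
  (isCompact_dirichletSphere VD).eventually_forall_of_forall_eventually fun x hx =>
    continuous_vertexForm.continuousAt.eventually_const_lt (h x hx)

/-- If a family of forms is positive definite for the parameter `a` and not for `b`, then there is
a parameter for which it is positive semidefinite and degenerate. -/
theorem exists_vertexForm_critical {VD : Set V} {a b : ℝ} (hab : a ≤ b)
    {c : ℝ → (E → ℝ) × (E → ℝ) × (V → ℝ)} (hc : ContinuousOn c (Set.Icc a b))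
    (ha : ∀ x ∈ dirichletSphere VD, 0 < G.vertexForm (c a) x x)
    (hb : ∃ x ∈ dirichletSphere VD, G.vertexForm (c b) x x ≤ 0) :
    ∃ k ∈ Set.Icc a b, (∀ x : V → ℝ, (∀ v ∈ VD, x v = 0) → 0 ≤ G.vertexForm (c k) x x) ∧
      ∃ x ∈ dirichletSphere VD, G.vertexForm (c k) x x = 0 := by
  have hS := isCompact_dirichletSphere VD
  have hcont : ContinuousOn (fun z : ℝ × (V → ℝ) => G.vertexForm (c z.1) z.2 z.2)
      (Set.Icc a b ×ˢ dirichletSphere VD) := by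
    refine continuous_vertexForm.comp_continuousOn (f := fun z : ℝ × (V → ℝ) => (c z.1, z.2)) ?_
    exact (hc.comp continuousOn_fst fun z hz => hz.1).prodMk continuousOn_snd
  have hK := isCompact_Icc.prod hS (s := Set.Icc a b)
  have hZ := hK.of_isClosed_subset
    (hcont.preimage_isClosed_of_isClosed hK.isClosed (isClosed_Iic (a := 0))) Set.inter_subset_left
  obtain ⟨xb, hxb, hxb0⟩ := hb
  -- The pairs with a nonpositive value form a compact set, so there is a least such parameter. A
  -- negative value there would, by the intermediate value theorem, force a zero at a smaller one.
  obtain ⟨k, ⟨⟨k', x⟩, ⟨⟨hk, hx⟩, hxk⟩, rfl⟩, hleast⟩ := (hZ.image continuous_fst).exists_isLeast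
    ⟨b, (b, xb), ⟨⟨⟨hab, le_rfl⟩, hxb⟩, hxb0⟩, rfl⟩
  have hnonneg : ∀ y ∈ dirichletSphere VD, 0 ≤ G.vertexForm (c k') y y := by
    intro y hy
    by_contra! hneg
    have hcy : ContinuousOn (fun k => G.vertexForm (c k) y y) (Set.Icc a k') :=
      hcont.comp (f := fun k => (k, y)) (by fun_prop) fun k hk2 => ⟨⟨hk2.1, hk2.2.trans hk.2⟩, hy⟩
    obtain ⟨d, hd, hd0⟩ := intermediate_value_Icc' hk.1 hcy ⟨hneg.le, (ha y hy).le⟩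
    have hle : k' ≤ d := hleast ⟨(d, y), ⟨⟨⟨hd.1, hd.2.trans hk.2⟩, hy⟩, hd0.le⟩, rfl⟩
    rw [le_antisymm hd.2 hle] at hd0
    exact hneg.ne hd0
  refine ⟨k', hk, fun y hy => ?_, x, hx, le_antisymm hxk (hnonneg x hx)⟩
  by_cases hy0 : y = 0
  · simp [hy0, vertexForm]
  · have hn : ‖y‖ ≠ 0 := norm_ne_zero_iff.2 hy0
    have h1 := hnonneg (‖y‖⁻¹ • y) ⟨fun v hv => by simp [hy v hv], by
      rw [norm_smul, norm_inv, norm_norm, inv_mul_cancel₀ hn]⟩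
    have h2 := vertexForm_smul_self (G := G) ‖y‖ (c k') (‖y‖⁻¹ • y)
    rw [smul_smul, mul_inv_cancel₀ hn, one_smul] at h2
    rw [h2]
    positivity

/-- Only the off-diagonal products notice the signs of `x`, and they enter with nonpositive
coefficients. -/
theorem vertexForm_abs_le {c : (E → ℝ) × (E → ℝ) × (V → ℝ)} (hc : ∀ e, 0 ≤ c.2.1 e) (x : V → ℝ) :
    G.vertexForm c |x| |x| ≤ G.vertexForm c x x := by
  simp only [vertexForm, Pi.abs_apply, ← abs_mul, abs_mul_self]
  gcongr with e _
  · exact hc e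
  · exact le_abs_self _
  · exact le_abs_self _

-- A null vector minimizes a semidefinite form, so its first variation vanishes in every direction
-- allowed by the Dirichlet conditions.
open Classical in
theorem vertexForm_single_eq_zero {VD : Set V} {c : (E → ℝ) × (E → ℝ) × (V → ℝ)}
    (hpos : ∀ x : V → ℝ, (∀ v ∈ VD, x v = 0) → 0 ≤ G.vertexForm c x x) {x : V → ℝ}
    (hx : ∀ v ∈ VD, x v = 0) (h0 : G.vertexForm c x x = 0) {v : V} (hv : v ∉ VD) :
    G.vertexForm c x (Pi.single v 1) = 0 := by
  set b := G.vertexForm c x (Pi.single v 1)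
  set D := G.vertexForm c (Pi.single v (1 : ℝ)) (Pi.single v 1)
  have key : ∀ d : ℝ, 0 ≤ 2 * d * b + d ^ 2 * D := by
    intro d
    have h1 := hpos (x + d • Pi.single v (1 : ℝ)) fun w hw => by
      have hwv : w ≠ v := fun h => hv (h ▸ hw)
      simp [hx w hw, Pi.single_eq_of_ne hwv]
    rwa [vertexForm_add_smul_self, h0, zero_add] at h1
  by_contra hb
  have hD : 0 < 1 + |D| := by positivity
  -- A step against the sign of `b`, short enough for the linear term to outweigh the quadratic one.
  have h1 := key (-b / (1 + |D|))
  have h2 : 2 * (-b / (1 + |D|)) * b + (-b / (1 + |D|)) ^ 2 * D =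
      b ^ 2 / (1 + |D|) ^ 2 * (D - 2 * (1 + |D|)) := by
    field_simp
    ring
  rw [h2] at h1
  have h3 : 0 < b ^ 2 / (1 + |D|) ^ 2 := by positivity
  nlinarith [le_abs_self D, abs_nonneg D]

/-- A nonnegative kernel vector is positive at all vertices outside of `VD`. -/
theorem Connected.pos_of_vertexForm_single_eq_zero (hG : G.Connected) {VD : Set V}
    (hVD : ∀ v ∈ VD, G.degree v = 1) {c : (E → ℝ) × (E → ℝ) × (V → ℝ)} (hc : ∀ e, 0 < c.2.1 e)
    {y : V → ℝ} (hy0 : y ≠ 0) (hy : 0 ≤ y) (hyD : ∀ v ∈ VD, y v = 0)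
    (hker : open Classical in ∀ v ∉ VD, G.vertexForm c y (Pi.single v 1) = 0) {v : V}
    (hv : v ∉ VD) : 0 < y v := by
  classical
  -- At a zero outside `VD` the kernel equation says that a sum of nonnegative terms with positive
  -- weights is zero, so all neighbours are zeros too.
  have hnb : ∀ v ∉ VD, y v = 0 → ∀ e, (G.init e = v → y (G.term e) = 0) ∧
      (G.term e = v → y (G.init e) = 0) := by
    intro v hv hyv
    have h1 := hker v hv
    rw [vertexForm_single, hyv, mul_zero, sub_zero] at h1
    have h2 : ∀ e, ((if G.init e = v then c.1 e * y (G.init e) - c.2.1 e * y (G.term e) else 0) +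
        (if G.term e = v then c.1 e * y (G.term e) - c.2.1 e * y (G.init e) else 0)) =
        -((if G.init e = v then c.2.1 e * y (G.term e) else 0) +
        (if G.term e = v then c.2.1 e * y (G.init e) else 0)) := by
      intro e
      split_ifs with h h' h' <;> simp [h, h', hyv]
    rw [Finset.sum_congr rfl fun e _ => h2 e, Finset.sum_neg_distrib, neg_eq_zero] at h1
    have nn1 : ∀ e, 0 ≤ if G.init e = v then c.2.1 e * y (G.term e) else 0 := fun e => by
      split_ifs
      · exact mul_nonneg (hc e).le (hy _)
      · exact le_rfl
    have nn2 : ∀ e, 0 ≤ if G.term e = v then c.2.1 e * y (G.init e) else 0 := fun e => by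
      split_ifs
      · exact mul_nonneg (hc e).le (hy _)
      · exact le_rfl
    rw [Finset.sum_eq_zero_iff_of_nonneg fun e _ => add_nonneg (nn1 e) (nn2 e)] at h1
    intro e
    have h3 := (add_eq_zero_iff_of_nonneg (nn1 e) (nn2 e)).1 (h1 e (Finset.mem_univ e))
    refine ⟨fun h => ?_, fun h => ?_⟩
    · have := h3.1
      rw [if_pos h] at this
      exact (mul_eq_zero.1 this).resolve_left (hc e).ne'
    · have := h3.2
      rw [if_pos h] at this
      exact (mul_eq_zero.1 this).resolve_left (hc e).ne'
  by_contra hyv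
  have hyv0 : y v = 0 := le_antisymm (not_lt.1 hyv) (hy v)
  -- At a Dirichlet vertex there is no kernel equation to spread the zero. Such a vertex is admitted
  -- only if its neighbour is a zero outside `VD`; having degree one, it has no other edge to check.
  let Z : Set V := {w | (w ∉ VD ∧ y w = 0) ∨ (w ∈ VD ∧ ∃ e,
    (G.init e = w ∧ G.term e ∉ VD ∧ y (G.term e) = 0) ∨
    (G.term e = w ∧ G.init e ∉ VD ∧ y (G.init e) = 0))}
  have hZ : ∀ w, w ∈ Z := by
    refine hG.forall_mem (fun e => ⟨?_, ?_⟩) (v := v) (Or.inl ⟨hv, hyv0⟩)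
    · rintro (⟨h1, h2⟩ | ⟨h1, e', ⟨h2, h3⟩ | ⟨h2, -⟩⟩)
      · have h3 := (hnb _ h1 h2 e).1 rfl
        by_cases ht : G.term e ∈ VD
        · exact Or.inr ⟨ht, e, Or.inr ⟨rfl, h1, h2⟩⟩
        · exact Or.inl ⟨ht, h3⟩
      · rw [eq_of_init_eq (hVD _ h1) h2] at h3
        exact Or.inl h3
      · exact absurd h2 (init_ne_term_of_degree_eq_one (hVD _ h1) rfl)
    · rintro (⟨h1, h2⟩ | ⟨h1, e', ⟨h2, -⟩ | ⟨h2, h3⟩⟩)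
      · have h3 := (hnb _ h1 h2 e).2 rfl
        by_cases ht : G.init e ∈ VD
        · exact Or.inr ⟨ht, e, Or.inl ⟨rfl, h1, h2⟩⟩
        · exact Or.inl ⟨ht, h3⟩
      · exact absurd rfl (init_ne_term_of_degree_eq_one (hVD _ h1) h2 (e' := e))
      · rw [eq_of_term_eq (hVD _ h1) h2] at h3
        exact Or.inl h3
  refine hy0 (funext fun w => ?_)
  obtain ⟨-, h⟩ | ⟨h, -⟩ := hZ w
  · exact h
  · exact hyD w h

end Form

end MetricGraph

/-! ### Sign change of the vertex form and eigenfunctions of full support -/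

namespace MetricGraph

open Filter Topology

variable {V E : Type*} {G : MetricGraph V E}

theorem cos_div_sin_lt_inv {θ : ℝ} (h0 : 0 < θ) (hπ : θ < Real.pi) :
    Real.cos θ / Real.sin θ < θ⁻¹ := by
  have hs := Real.sin_pos_of_pos_of_lt_pi h0 hπ
  rcases lt_or_ge θ (Real.pi / 2) with h | h
  · have hc := Real.cos_pos_of_mem_Ioo ⟨by linarith, h⟩
    have := Real.lt_tan h0 h
    rw [Real.tan_eq_sin_div_cos, lt_div_iff₀ hc] at this
    rw [div_lt_iff₀ hs, inv_mul_eq_div, lt_div_iff₀ h0]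
    linarith
  · have hc := Real.cos_nonpos_of_pi_div_two_le_of_le h (by linarith)
    exact (div_nonpos_of_nonpos_of_nonneg hc hs.le).trans_lt (inv_pos.2 h0)

theorem cos_div_sin_pi_sub_arctan (x : ℝ) :
    Real.cos (Real.pi - Real.arctan x⁻¹) / Real.sin (Real.pi - Real.arctan x⁻¹) = -x := by
  have h := Real.tan_arctan x⁻¹
  rw [Real.tan_eq_sin_div_cos] at h
  rw [Real.cos_pi_sub, Real.sin_pi_sub, neg_div, ← inv_div, h, inv_inv]

theorem tendsto_div_sin {ℓ : ℝ} (hℓ : 0 < ℓ) :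
    Tendsto (fun δ => δ / Real.sin (δ * ℓ)) (𝓝[>] 0) (𝓝 ℓ⁻¹) := by
  have h1 : HasDerivAt (fun δ : ℝ => Real.sin (δ * ℓ)) ℓ 0 := by
    have := ((hasDerivAt_id (0 : ℝ)).mul_const ℓ).sin
    simpa using this
  have h2 := (h1.tendsto_slope_zero_right).inv₀ hℓ.ne'
  refine h2.congr fun δ => ?_
  simp [div_eq_mul_inv, mul_comm]

variable (G) in
/-- The form coefficients of the graph without potentials and couplings for the energy `δ ^ 2`,
divided by `δ`. -/
noncomputable def freeCoeff (δ : ℝ) : (E → ℝ) × (E → ℝ) × (V → ℝ) :=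
  (fun e => Real.cos (δ * G.len e) / Real.sin (δ * G.len e),
    fun e => 1 / Real.sin (δ * G.len e), 0)

variable (G) in
/-- The form coefficients for the energy `k ^ 2`, divided by `k`. -/
noncomputable def energyCoeff (α : V → ℝ) (q : E → ℝ) (m : E → ℤ) (k : ℝ) :
    (E → ℝ) × (E → ℝ) × (V → ℝ) :=
  (fun e => √(k ^ 2 - q e) / k * (Real.cos (shiftedPhase (q e) (G.len e) (m e) k) /
      Real.sin (shiftedPhase (q e) (G.len e) (m e) k)),
    fun e => √(k ^ 2 - q e) / k * (1 / Real.sin (shiftedPhase (q e) (G.len e) (m e) k)),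
    fun v => α v / k)

/-- Along the recurrence times, potentials and couplings disappear from the form, so strict signs of
the free form transfer to high energies. -/
theorem tendsto_energyCoeff {t : ℕ → ℝ} {m : ℕ → E → ℤ} (ht : Tendsto t atTop atTop)
    (hm : ∀ e, Tendsto (fun n => t n * G.len e - m n e * (2 * Real.pi)) atTop (𝓝 0))
    (α : V → ℝ) (q : E → ℝ) {δ : ℝ} (hδ : ∀ e, Real.sin (δ * G.len e) ≠ 0) :
    Tendsto (fun n => G.energyCoeff α q (m n) (t n + δ)) atTop (𝓝 (G.freeCoeff δ)) := by
  have htd := tendsto_atTop_add_const_right _ δ ht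
  have hr : ∀ e, Tendsto (fun n => √((t n + δ) ^ 2 - q e) / (t n + δ)) atTop (𝓝 1) := fun e =>
    (tendsto_sqrt_sq_sub_div (q e)).comp htd
  have hsin : ∀ e, Tendsto (fun n => Real.sin (shiftedPhase (q e) (G.len e) (m n e) (t n + δ)))
      atTop (𝓝 (Real.sin (δ * G.len e))) := fun e =>
    (Real.continuous_sin.tendsto _).comp (tendsto_shiftedPhase ht (hm e) δ)
  have hcos : ∀ e, Tendsto (fun n => Real.cos (shiftedPhase (q e) (G.len e) (m n e) (t n + δ)))
      atTop (𝓝 (Real.cos (δ * G.len e))) := fun e =>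
    (Real.continuous_cos.tendsto _).comp (tendsto_shiftedPhase ht (hm e) δ)
  refine Tendsto.prodMk_nhds (tendsto_pi_nhds.2 fun e => ?_)
    (Tendsto.prodMk_nhds (tendsto_pi_nhds.2 fun e => ?_) (tendsto_pi_nhds.2 fun v => ?_))
  · have := (hr e).mul ((hcos e).div (hsin e) (hδ e))
    rwa [one_mul] at this
  · have := (hr e).mul ((tendsto_const_nhds (x := (1 : ℝ))).div (hsin e) (hδ e))
    rwa [one_mul] at this
  · exact tendsto_const_nhds.div_atTop htd

section Form

variable [Fintype V] [Fintype E]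

/-- This is the weighted discrete Dirichlet energy: it vanishes only on constants, which a Dirichlet
vertex excludes. -/
theorem vertexForm_inv_len_pos (hG : G.Connected) {VD : Set V} (hVD : VD.Nonempty) {x : V → ℝ}
    (hx : x ∈ dirichletSphere VD) :
    0 < G.vertexForm (fun e => (G.len e)⁻¹, fun e => (G.len e)⁻¹, 0) x x := by
  have h1 : G.vertexForm (fun e => (G.len e)⁻¹, fun e => (G.len e)⁻¹, 0) x x =
      ∑ e, (G.len e)⁻¹ * (x (G.init e) - x (G.term e)) ^ 2 := by
    simp only [vertexForm, Pi.zero_apply, zero_mul, Finset.sum_const_zero, sub_zero]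
    refine Finset.sum_congr rfl fun e _ => ?_
    ring
  have hnn : ∀ e, 0 ≤ (G.len e)⁻¹ * (x (G.init e) - x (G.term e)) ^ 2 := fun e =>
    mul_nonneg (inv_nonneg.2 (G.len_pos e).le) (sq_nonneg _)
  rw [h1]
  refine lt_of_le_of_ne (Finset.sum_nonneg fun e _ => hnn e) fun h => ?_
  rw [eq_comm, Finset.sum_eq_zero_iff_of_nonneg fun e _ => hnn e] at h
  have h2 : ∀ e, x (G.init e) = x (G.term e) := fun e => by
    have h3 := (mul_eq_zero.1 (h e (Finset.mem_univ e))).resolve_left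
      (inv_ne_zero (G.len_pos e).ne')
    exact sub_eq_zero.1 (pow_eq_zero_iff two_ne_zero |>.1 h3)
  obtain ⟨o, ho⟩ := hVD
  have hx0 : x = 0 := funext fun v => by
    rw [hG.eq_of_forall_edge h2 o v, hx.1 o ho, Pi.zero_apply]
  have := hx.2
  rw [hx0, norm_zero] at this
  exact zero_ne_one this

/-- Multiplied by `δ`, the coefficients tend to the inverse edge lengths as `δ → 0`. -/
theorem eventually_vertexForm_freeCoeff_pos (hG : G.Connected) {VD : Set V} (hVD : VD.Nonempty) :
    ∀ᶠ δ in 𝓝[>] (0 : ℝ), ∀ x ∈ dirichletSphere VD, 0 < G.vertexForm (G.freeCoeff δ) x x := by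
  have hlim : Tendsto (fun δ => δ • G.freeCoeff δ) (𝓝[>] 0)
      (𝓝 (fun e => (G.len e)⁻¹, fun e => (G.len e)⁻¹, 0)) := by
    refine Tendsto.prodMk_nhds (tendsto_pi_nhds.2 fun e => ?_)
      (Tendsto.prodMk_nhds (tendsto_pi_nhds.2 fun e => ?_) ?_)
    · have h1 : Tendsto (fun δ : ℝ => Real.cos (δ * G.len e)) (𝓝[>] 0) (𝓝 1) := by
        have : Continuous fun δ : ℝ => Real.cos (δ * G.len e) := by fun_prop
        simpa using (this.tendsto 0).mono_left nhdsWithin_le_nhds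
      have h2 := h1.mul (tendsto_div_sin (G.len_pos e))
      rw [one_mul] at h2
      refine h2.congr fun δ => ?_
      simp only [freeCoeff, Pi.smul_apply, smul_eq_mul]
      ring
    · refine (tendsto_div_sin (G.len_pos e)).congr fun δ => ?_
      simp only [freeCoeff, Pi.smul_apply, smul_eq_mul]
      ring
    · simp only [freeCoeff, smul_zero]
      exact tendsto_const_nhds
  filter_upwards [hlim.eventually (eventually_vertexForm_pos fun x hx =>
    vertexForm_inv_len_pos hG hVD hx), self_mem_nhdsWithin] with δ hδ hδ0 x hx
  have := hδ x hx
  rw [vertexForm_smul_left] at this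
  exact pos_of_mul_pos_right this (le_of_lt hδ0)

/-- As the phase of the longest edge approaches `π`, its cotangent tends to `-∞`, while the other
phases stay below `π` and positive contributions stay bounded. The indicator of a free end of that
edge is the test vector. -/
theorem exists_vertexForm_freeCoeff_neg [Nonempty E] {VD : Set V}
    (hVD : ∀ e, G.init e ∈ VD → G.term e ∉ VD) :
    ∃ δ > 0,
      (∀ e, δ * G.len e < Real.pi) ∧
      ∃ x ∈ dirichletSphere VD, G.vertexForm (G.freeCoeff δ) x x < 0 := by
  classical
  obtain ⟨e₀, he₀⟩ := Finite.exists_max G.len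
  set L := G.len e₀
  have hL : 0 < L := G.len_pos e₀
  obtain ⟨v, hv, hve⟩ : ∃ v ∉ VD, G.init e₀ = v ∨ G.term e₀ = v := by
    by_cases h : G.init e₀ ∈ VD
    · exact ⟨_, hVD e₀ h, Or.inr rfl⟩
    · exact ⟨_, h, Or.inl rfl⟩
  -- Since `θ > π / 2`, each cotangent is at most `2 * L / (π * len e)`, and an edge contributes at
  -- most two of them, the second for a loop. The cotangent on `e₀` is set to `-(C + 1)`, leaving a
  -- total of at most `-1`.
  set C := ∑ e, 4 * L / (Real.pi * G.len e) with hC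
  have hCnn : ∀ e, 0 < 4 * L / (Real.pi * G.len e) := fun e =>
    div_pos (by positivity) (mul_pos Real.pi_pos (G.len_pos e))
  have hC0 : 0 ≤ C := Finset.sum_nonneg fun e _ => (hCnn e).le
  set θ := Real.pi - Real.arctan (C + 1)⁻¹ with hθ
  have hat : 0 < Real.arctan (C + 1)⁻¹ := by
    rw [← Real.arctan_zero]
    exact Real.arctan_strictMono (by positivity)
  have hθ1 : Real.pi / 2 < θ := by
    have := Real.arctan_lt_pi_div_two (C + 1)⁻¹
    rw [hθ]
    linarith
  have hθ2 : θ < Real.pi := by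
    rw [hθ]
    linarith
  have hθ0 : 0 < θ := by linarith [Real.pi_pos]
  have hδ : 0 < θ / L := by positivity
  have hδL : θ / L * L = θ := div_mul_cancel₀ _ hL.ne'
  have hlt : ∀ e, θ / L * G.len e < Real.pi := fun e =>
    (mul_le_mul_of_nonneg_left (he₀ e) hδ.le).trans_lt (hδL.trans_lt hθ2)
  have hpos : ∀ e, 0 < θ / L * G.len e := fun e => mul_pos hδ (G.len_pos e)
  refine ⟨θ / L, hδ, hlt, Pi.single v 1,
    ⟨fun w hw => Pi.single_eq_of_ne (fun h => hv (by rwa [← h])) _, ?_⟩, ?_⟩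
  · rw [Pi.norm_single, norm_one]
  have hcot : ∀ e, Real.cos (θ / L * G.len e) / Real.sin (θ / L * G.len e) ≤
      2 * L / (Real.pi * G.len e) := by
    intro e
    refine (cos_div_sin_lt_inv (hpos e) (hlt e)).le.trans ?_
    have h1 := G.len_pos e
    have h2 : Real.pi * G.len e / (2 * L) ≤ θ / L * G.len e := by
      rw [div_mul_eq_mul_div, div_le_div_iff₀ (by positivity) hL]
      nlinarith [mul_pos hL h1]
    rw [← inv_div (Real.pi * G.len e)]
    exact inv_anti₀ (div_pos (mul_pos Real.pi_pos h1) (by positivity)) h2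
  have hsin : ∀ e, 0 < 1 / Real.sin (θ / L * G.len e) := fun e =>
    one_div_pos.2 (Real.sin_pos_of_pos_of_lt_pi (hpos e) (hlt e))
  have hcot0 : Real.cos (θ / L * G.len e₀) / Real.sin (θ / L * G.len e₀) = -(C + 1) := by
    change Real.cos (θ / L * L) / Real.sin (θ / L * L) = _
    rw [hδL]
    exact cos_div_sin_pi_sub_arctan _
  rw [vertexForm_single]
  have hterm : ∀ e, ((if G.init e = v then (G.freeCoeff (θ / L)).1 e *
        (Pi.single v (1 : ℝ) : V → ℝ) (G.init e) -
        (G.freeCoeff (θ / L)).2.1 e * (Pi.single v (1 : ℝ) : V → ℝ) (G.term e) else 0) +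
      (if G.term e = v then (G.freeCoeff (θ / L)).1 e *
        (Pi.single v (1 : ℝ) : V → ℝ) (G.term e) -
        (G.freeCoeff (θ / L)).2.1 e * (Pi.single v (1 : ℝ) : V → ℝ) (G.init e) else 0)) ≤
      (if e = e₀ then -(C + 1) else 0) + 4 * L / (Real.pi * G.len e) := by
    intro e
    have h1 := hcot e
    have h2 := hsin e
    have h3 := hCnn e
    have h4 : 4 * L / (Real.pi * G.len e) = 2 * (2 * L / (Real.pi * G.len e)) := by ring
    simp only [freeCoeff, Pi.single_apply]
    by_cases he : e = e₀
    · subst he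
      rw [hcot0]
      rcases hve with h | h
      · by_cases h' : G.term e = v
        · simp only [h, h', if_true]
          linarith
        · simp only [h, h', if_true, if_false]
          linarith
      · by_cases h' : G.init e = v
        · simp only [h, h', if_true]
          linarith
        · simp only [h, h', if_true, if_false]
          linarith
    · rw [if_neg he]
      split_ifs <;> linarith
  have hsum := Finset.sum_le_sum fun e (_ : e ∈ Finset.univ) => hterm e
  have hbound : ∑ e, ((if e = e₀ then -(C + 1) else 0) + 4 * L / (Real.pi * G.len e)) = -1 := by
    rw [Finset.sum_add_distrib, Finset.sum_ite_eq' Finset.univ e₀, if_pos (Finset.mem_univ _),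
      ← hC]
    ring
  rw [hbound] at hsum
  have h0 : (G.freeCoeff (θ / L)).2.2 v = 0 := rfl
  rw [h0, zero_mul, sub_zero]
  linarith

open Classical in
/-- A kernel vector of the form for the energy `k ^ 2` is the vector of vertex values of an
eigenfunction. -/
theorem exists_mem_eigenspace_of_vertexForm_single {VD : Set V} {α : V → ℝ} {q : E → ℝ}
    {m : E → ℤ} {k : ℝ} (hk : 0 < k) (hq : ∀ e, q e < k ^ 2)
    (hsin : ∀ e, Real.sin (shiftedPhase (q e) (G.len e) (m e) k) ≠ 0) {y : V → ℝ}
    (hyD : ∀ v ∈ VD, y v = 0)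
    (hker : ∀ v ∉ VD, G.vertexForm (G.energyCoeff α q m k) y (Pi.single v 1) = 0) :
    ∃ ψ ∈ G.eigenspace VD α q (k ^ 2), ∀ e, ψ e (G.initPt e) = y (G.init e) ∧
      ψ e (G.termPt e) = y (G.term e) := by
  set κ : E → ℝ := fun e => √(k ^ 2 - q e) with hκ
  have hsin' : ∀ e, Real.sin (κ e * G.len e) ≠ 0 := fun e => by
    rw [← sin_shiftedPhase _ _ (m e)]
    exact hsin e
  -- The nonzero sine lets the edge condition determine `B` from the vertex values; the flux
  -- condition at `v` is then `k` times the kernel equation.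
  set B : E → ℝ := fun e => (y (G.term e) - y (G.init e) * Real.cos (κ e * G.len e)) /
    Real.sin (κ e * G.len e) with hB
  have hedge : ∀ e, y (G.term e) = y (G.init e) * Real.cos (κ e * G.len e) +
      B e * Real.sin (κ e * G.len e) := fun e => by
    rw [hB, div_mul_cancel₀ _ (hsin' e)]
    ring
  refine ⟨G.trigFun κ y B, trigFun_mem_eigenspace G
    (fun e => Real.sq_sqrt (sub_nonneg.2 (hq e).le)) hyD hedge fun v hv => ?_, fun e => ⟨?_, ?_⟩⟩
  · have h1 := hker v hv
    rw [vertexForm_single, sub_eq_zero] at h1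
    have h2 : α v * y v = k * (α v / k * y v) := by
      rw [← mul_assoc, mul_div_cancel₀ _ hk.ne']
    rw [h2, ← show _ = α v / k * y v from h1, trigFlux, Finset.mul_sum]
    refine Finset.sum_congr rfl fun e _ => ?_
    simp only [energyCoeff, cos_shiftedPhase, sin_shiftedPhase, mul_add, mul_ite, mul_zero]
    have hs := hsin' e
    have hsc := Real.sin_sq_add_cos_sq (κ e * G.len e)
    simp only [hκ] at hs hsc
    congr 1
    · refine if_congr Iff.rfl ?_ rfl
      simp only [hB, hκ]
      field_simp
      ring
    · refine if_congr Iff.rfl ?_ rfl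
      simp only [hB, hκ]
      field_simp
      linear_combination (-√(k ^ 2 - q e) * y (G.init e)) * hsc
  · simp [trigFun, initPt]
  · rw [hedge e]
    rfl

/-- If some, but no two adjacent vertices carry Dirichlet conditions, then there are arbitrarily
large eigenvalues with an eigenfunction of full support. -/
theorem Connected.exists_gt_fullSupport [Nonempty E] (hG : G.Connected) {VD : Set V}
    (hdeg : ∀ v ∈ VD, G.degree v = 1) (hne : VD.Nonempty)
    (hVD : ∀ e, G.init e ∈ VD → G.term e ∉ VD) (α : V → ℝ) (q : E → ℝ) (K : ℝ) :
    ∃ lam, K < lam ∧ ∃ ψ, G.IsEigenfunction VD α q lam ψ ∧ G.HasFullSupport ψ := by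
  classical
  obtain ⟨t, m, ht, hm⟩ := exists_tendsto_mul_sub_int_mul_two_pi G.len
  obtain ⟨b, hb, hbπ, x₁, hx₁, hx₁b⟩ := exists_vertexForm_freeCoeff_neg hVD
  obtain ⟨a, hapos, hab, ha⟩ := ((eventually_vertexForm_freeCoeff_pos hG hne).and
    ((eventually_lt_nhds hb |>.filter_mono nhdsWithin_le_nhds).and self_mem_nhdsWithin)).exists
  have hsinfree : ∀ d, 0 < d → d ≤ b → ∀ e, Real.sin (d * G.len e) ≠ 0 := fun d hd hdb e =>
    (Real.sin_pos_of_pos_of_lt_pi (mul_pos hd (G.len_pos e))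
      ((mul_le_mul_of_nonneg_right hdb (G.len_pos e).le).trans_lt (hbπ e))).ne'
  have e1 : ∀ᶠ n in atTop, ∀ x ∈ dirichletSphere VD,
      0 < G.vertexForm (G.energyCoeff α q (m n) (t n + a)) x x :=
    (tendsto_energyCoeff ht hm α q (hsinfree a ha hab.le)).eventually
      (eventually_vertexForm_pos hapos)
  have e2 : ∀ᶠ n in atTop, G.vertexForm (G.energyCoeff α q (m n) (t n + b)) x₁ x₁ < 0 := by
    have hcont : Continuous fun c : (E → ℝ) × (E → ℝ) × (V → ℝ) => G.vertexForm c x₁ x₁ :=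
      continuous_vertexForm.comp (f := fun c => (c, x₁)) (by fun_prop)
    exact ((hcont.tendsto _).comp
      (tendsto_energyCoeff ht hm α q (hsinfree b hb le_rfl))).eventually_lt_const hx₁b
  have e3 : ∀ᶠ n in atTop, ∀ e, shiftedPhase (q e) (G.len e) (m n e) (t n + b) < Real.pi :=
    eventually_all.2 fun e => (tendsto_shiftedPhase ht (hm e) b).eventually_lt_const (hbπ e)
  have e4 : ∀ᶠ n in atTop, ∀ e, 0 < shiftedPhase (q e) (G.len e) (m n e) (t n + a) :=
    eventually_all.2 fun e => (tendsto_shiftedPhase ht (hm e) a).eventually_const_lt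
      (mul_pos ha (G.len_pos e))
  have hk : ∀ᶠ k : ℝ in atTop, 0 < k ∧ K < k ^ 2 ∧ ∀ e, q e < k ^ 2 := by
    have hsq : Tendsto (fun k : ℝ => k ^ 2) atTop atTop := tendsto_pow_atTop two_ne_zero
    exact (eventually_gt_atTop 0).and ((hsq.eventually_gt_atTop K).and
      (eventually_all.2 fun e => hsq.eventually_gt_atTop (q e)))
  obtain ⟨K', hK'⟩ := eventually_atTop.1 hk
  have e5 := (tendsto_atTop_add_const_right _ a ht).eventually_ge_atTop K'
  obtain ⟨n, h1, h2, h3, h4, h5⟩ := (e1.and (e2.and (e3.and (e4.and e5)))).exists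
  have hsin : ∀ k ∈ Set.Icc (t n + a) (t n + b), ∀ e,
      0 < Real.sin (shiftedPhase (q e) (G.len e) (m n e) k) := fun k hk' e =>
    Real.sin_pos_of_pos_of_lt_pi
      ((h4 e).trans_le (shiftedPhase_mono (G.len_pos e).le _ (hK' _ h5).1.le hk'.1))
      ((shiftedPhase_mono (G.len_pos e).le _ ((hK' _ h5).1.le.trans hk'.1) hk'.2).trans_lt (h3 e))
  have hcont : ContinuousOn (G.energyCoeff α q (m n)) (Set.Icc (t n + a) (t n + b)) := by
    intro k hk'
    have hk0 : k ≠ 0 := (hK' k (h5.trans hk'.1)).1.ne'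
    refine ContinuousAt.continuousWithinAt ?_
    have hr : ∀ e, ContinuousAt (fun k => √(k ^ 2 - q e) / k) k := fun e =>
      ContinuousAt.div (by fun_prop) continuousAt_id hk0
    have hph : ∀ e, ContinuousAt (shiftedPhase (q e) (G.len e) (m n e)) k := fun e =>
      (continuous_shiftedPhase _ _ _).continuousAt
    refine ContinuousAt.prodMk (continuousAt_pi.2 fun e => ?_)
      (ContinuousAt.prodMk (continuousAt_pi.2 fun e => ?_) (continuousAt_pi.2 fun v => ?_))
    · exact (hr e).mul ((Real.continuous_cos.continuousAt.comp (hph e)).div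
        (Real.continuous_sin.continuousAt.comp (hph e)) (hsin k hk' e).ne')
    · exact (hr e).mul (continuousAt_const.div
        (Real.continuous_sin.continuousAt.comp (hph e)) (hsin k hk' e).ne')
    · exact ContinuousAt.div continuousAt_const continuousAt_id hk0
  -- On the whole interval the phases lie in `(0, π)`, so the coefficients are continuous and the
  -- off-diagonal ones have the right sign.
  obtain ⟨k, hk', hpos, x, hx, hx0⟩ := exists_vertexForm_critical (by linarith) hcont h1
    ⟨x₁, hx₁, h2.le⟩
  obtain ⟨k0, kK, kq⟩ := hK' k (h5.trans hk'.1)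
  have hcoeff : ∀ e, 0 < (G.energyCoeff α q (m n) k).2.1 e := fun e =>
    mul_pos (div_pos (Real.sqrt_pos.2 (sub_pos.2 (kq e))) k0) (one_div_pos.2 (hsin k hk' e))
  have habsD : ∀ v ∈ VD, |x| v = 0 := fun v hv => by simp [hx.1 v hv]
  have habs0 : G.vertexForm (G.energyCoeff α q (m n) k) |x| |x| = 0 :=
    le_antisymm ((vertexForm_abs_le (fun e => (hcoeff e).le) x).trans hx0.le) (hpos _ habsD)
  have hker := fun v (hv : v ∉ VD) => vertexForm_single_eq_zero hpos habsD habs0 hv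
  have hxne : |x| ≠ 0 := fun h => by
    have := hx.2
    rw [show x = 0 from funext fun v => abs_eq_zero.1 (congrFun h v), norm_zero] at this
    exact zero_ne_one this
  have hxpos := fun v (hv : v ∉ VD) => hG.pos_of_vertexForm_single_eq_zero hdeg hcoeff hxne
    (abs_nonneg x) habsD hker hv
  obtain ⟨ψ, hψ, hval⟩ := exists_mem_eigenspace_of_vertexForm_single k0 kq
    (fun e => (hsin k hk' e).ne') habsD hker
  -- Every edge has an end outside `VD`, where the eigenfunction is positive.
  have hsupp : G.HasFullSupport ψ := fun e => by
    by_cases h : G.init e ∈ VD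
    · exact ⟨G.termPt e, by rw [(hval e).2]; exact (hxpos _ (hVD e h)).ne'⟩
    · exact ⟨G.initPt e, by rw [(hval e).1]; exact (hxpos _ h).ne'⟩
  refine ⟨k ^ 2, kK, ψ, ⟨hψ, fun h => ?_⟩, hsupp⟩
  obtain ⟨e⟩ := ‹Nonempty E›
  obtain ⟨z, hz⟩ := hsupp e
  exact hz (by rw [h]; rfl)

end Form

/-- An interval with Dirichlet conditions at both ends has arbitrarily large eigenvalues. -/
theorem exists_gt_fullSupport_interval [Fintype E] [Subsingleton E] {VD : Set V} {e : E}
    (hV : ∀ v, v ∈ VD) (α : V → ℝ) (q : E → ℝ) (K : ℝ) :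
    ∃ lam, K < lam ∧ ∃ ψ, G.IsEigenfunction VD α q lam ψ ∧ G.HasFullSupport ψ := by
  have hlen := G.len_pos e
  have hlim : Tendsto (fun n : ℕ => (((n : ℝ) * Real.pi) / G.len e) ^ 2 + q e) atTop atTop := by
    refine tendsto_atTop_add_const_right _ _ ((tendsto_pow_atTop two_ne_zero).comp ?_)
    exact (tendsto_natCast_atTop_atTop.atTop_mul_const Real.pi_pos).atTop_div_const hlen
  obtain ⟨n, hn, hn0⟩ := ((hlim.eventually_gt_atTop K).and (eventually_gt_atTop 0)).exists
  set κ : ℝ := ((n : ℝ) * Real.pi) / G.len e with hκ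
  have hκ0 : 0 < κ := by positivity
  have hκℓ : κ * G.len e = n * Real.pi := div_mul_cancel₀ _ hlen.ne'
  have hmem : G.trigFun (fun _ => κ) 0 1 ∈ G.eigenspace VD α q (κ ^ 2 + q e) := by
    refine trigFun_mem_eigenspace G (fun e' => ?_) (fun _ _ => rfl) (fun e' => ?_)
      fun v hv => absurd (hV v) hv
    · rw [Subsingleton.elim e' e]
      ring
    · rw [Subsingleton.elim e' e, hκℓ, Real.sin_nat_mul_pi]
      simp
  have hsupp : G.HasFullSupport (G.trigFun (fun _ => κ) 0 1) := by
    intro e'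
    rw [Subsingleton.elim e' e]
    -- A quarter of the wavelength, where the sine equals one; it fits in the edge because `n ≥ 1`.
    have hmid : 0 ≤ Real.pi / 2 / κ ∧ Real.pi / 2 / κ ≤ G.len e := by
      refine ⟨by positivity, ?_⟩
      rw [div_le_iff₀ hκ0, mul_comm, hκℓ]
      have : (1 : ℝ) ≤ n := Nat.one_le_cast.2 hn0
      nlinarith [Real.pi_pos]
    refine ⟨⟨_, hmid⟩, ?_⟩
    simp [trigFun, mul_div_cancel₀ _ hκ0.ne']
  refine ⟨_, hn, _, ⟨hmem, fun h => ?_⟩, hsupp⟩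
  obtain ⟨z, hz⟩ := hsupp e
  exact hz (by rw [h]; rfl)

end MetricGraph

/-! ### The two statements -/

theorem theorem4 {V E : Type*} [Fintype V] [Fintype E] [Nonempty E] (G : MetricGraph V E)
    (hG : G.Connected) (VD : Set V) (hVD : ∀ v ∈ VD, G.degree v = 1)
    (α : V → ℝ) (q : E → ℝ) :
    (G.IsTree → VD = ∅ →
      ∃ (lam : ℕ → ℝ) (ψ : ℕ → G.EdgeFun), StrictMono lam ∧
        ∀ k, Module.finrank ℝ (G.eigenspace VD α q (lam k)) = 1 ∧
          G.IsEigenfunction VD α q (lam k) (ψ k) ∧ ∀ v, G.NonvanishingAt (ψ k) v) ∧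
    (VD.Nonempty →
      ∃ (lam : ℕ → ℝ) (ψ : ℕ → G.EdgeFun), StrictMono lam ∧
        ∀ k, G.IsEigenfunction VD α q (lam k) (ψ k) ∧ G.HasFullSupport (ψ k)) := by
  constructor
  · rintro htree rfl
    obtain ⟨lam, hlam, h⟩ := exists_strictMono_of_forall_exists_gt (htree.exists_gt_simple α q)
    choose h1 ψ hψ using h
    exact ⟨lam, ψ, hlam, fun k => ⟨h1 k, hψ k⟩⟩
  · intro hne
    have hex : ∀ K, ∃ lam, K < lam ∧ ∃ ψ, G.IsEigenfunction VD α q lam ψ ∧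
        G.HasFullSupport ψ := by
      by_cases hends : ∀ e, G.init e ∈ VD → G.term e ∉ VD
      · exact hG.exists_gt_fullSupport hVD hne hends α q
      · push Not at hends
        obtain ⟨e, hi, ht⟩ := hends
        have hsub := hG.subsingleton_of_degree_eq_one (hVD _ hi) (hVD _ ht)
        refine MetricGraph.exists_gt_fullSupport_interval (e := e) ?_ α q
        refine hG.forall_mem (fun e' => ?_) hi
        rw [Subsingleton.elim e' e]
        exact iff_of_true hi ht
    obtain ⟨lam, hlam, h⟩ := exists_strictMono_of_forall_exists_gt hex
    choose ψ hψ using h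
    exact ⟨lam, ψ, hlam, hψ⟩
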